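/- **Setting.** Let $n,d\ge 1$, $B>0$, $\epsilon\in(0,0.1)$, and let $Q,K,V\in\mathbb R^{n\times d}$ with $\|Q\|_\infty\le B$, $\|K\|_\infty\le B$, where $\|A\|_\infty=\max_{i,j}|A_{i,j}|$. Let $H=\exp(QK^\top/d)\in\mathbb R^{n\times n}$ (entrywise exponential). For $k\ge1$ and $U_1,U_2\in\mathbb R^{n\times k}$, call $U_1U_2^\top$ an $(\epsilon,k)$-approximation of $H$ if its entries are nonnegative and $|(U_1U_2^\top)_{i,j}-H_{i,j}|\le\epsilon H_{i,j}$ for all $i,j$. Let $W\in\{0,1\}^{n\times n}$ be a mask each of whose rows contains a $1$. Put $$A=W\circ H,\quad D=\mathrm{diag}(A\mathbf 1_n),\quad Y=D^{-1}AV,\qquad \widetilde A=W\circ(U_1U_2^\top),\quad \widetilde D=\mathrm{diag}(\widetilde A\mathbf 1_n),\quad \widetilde Y=\widetilde D^{-1}\widetilde AV,$$ where $\circ$ is the entrywise product. Running times are numbers of steps of fixed programs (not depending on $n,d,k$ or on any other part of the input) on a real RAM with unit-cost arithmetic and tests and without exponentials, logarithms or rounding. All $O(\cdot)$ constants are absolute.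 **Theorem.** 1. (Low-rank factors.) There are integers $g\ge1$ and $k\ge1$ with $$g= O\Big(\max\Big\{1,\ \tfrac{\log(1/\epsilon)}{\log(\log(1/\epsilon)/B^2)},\ B^2\Big\}\Big),\qquad k\le\binom{2(g+d)}{2g}$$ (the second term in the maximum is present only if $B^2<\log(1/\epsilon)$), and $U_1,U_2\in\mathbb R^{n\times k}$ such that $U_1U_2^\top$ is an $(\epsilon,k)$-approximation of $H$; moreover $k$, $U_1$, $U_2$ are computable from $n,d,g,Q,K$ in $O(nk)$ time. 2. (Error.) For all $k\ge 1$ and $U_1,U_2\in\mathbb R^{n\times k}$ for which $U_1U_2^\top$ is an $(\epsilon,k)$-approximation of $H$, in particular for those of part 1, and for every mask $W$ as above, $D$ and $\widetilde D$ are invertible and $$\|Y-\widetilde Y\|_\infty\le4\epsilon\|V\|_\infty .$$ 3. (Time.) For such $k,U_1,U_2,W$, the matrix $\widetilde Y$ is computable from $n,d,k,U_1,U_2,V$ and the description of the mask indicated below in time * $O(knd)$ if $W$ is the causal mask ($W_{i,j}=1$ iff $i\ge j$); * $O\big(kd\max\{n,\sum_{j=1}^nB_j\}\big)$, that is $O(kd\sum_jB_j)$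 as soon as $\sum_jB_j\ge n$, if $W$ is a row change mask: $\|W_{j,*}-W_{j-1,*}\|_1\le B_j$ for all $j\in[n]$, where $B_j\in\mathbb Z_{\ge0}$ and $W_{0,*}=\mathbf 0_n$; the mask is given by the lists of $S_j\setminus S_{j-1}$ and $S_{j-1}\setminus S_j$, where $S_j$ is the support of row $j$ and $S_0=\emptyset$; * $O(knd\log n)$, for $n\ge2$, if $W$ is a continuous row mask: there are $s_i,t_i\in[n]$ with $W_{i,j}=1$ iff $s_i\le j\le t_i$; the mask is given by the $s_i,t_i$; * $O(krnd)$ if $W$ is a distinct $r$ columns (respectively rows) mask: $[n]$ is the union of $r$ disjoint sets $S_1,\dots,S_r$, and columns (respectively rows) of $W$ with indices in the same $S_j$ are equal; the mask is given by $r$, by the number $j$ of the set $S_j$ containing each index, and by the entries of $W$. -/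

import Mathlib

open Matrix

/- The norm on real matrices is the entrywise maximum norm `‖A‖ = max |A i j|`. -/
attribute [local instance] Matrix.normedAddCommGroup

namespace MaskedAttention

/-! ### Masked attention and its low-rank approximation -/

/-- `H = exp (Q Kᵀ / d)`, with the exponential taken entrywise. -/
noncomputable def expScores {n d : ℕ} (Q K : Matrix (Fin n) (Fin d) ℝ) :
    Matrix (Fin n) (Fin n) ℝ :=
  Matrix.of fun i j => Real.exp ((Q * Kᵀ) i j / d)

/-- The diagonal matrix `diag (A 1)` of the row sums of `A`. -/
def rowSumDiag {n : ℕ} (A : Matrix (Fin n) (Fin n) ℝ) : Matrix (Fin n) (Fin n) ℝ :=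
  Matrix.diagonal (A *ᵥ 1)

/-- `D⁻¹ A V`, where `A = W ∘ G` and `D = diag (A 1)`. -/
noncomputable def maskedAttention {n d : ℕ} (W G : Matrix (Fin n) (Fin n) ℝ)
    (V : Matrix (Fin n) (Fin d) ℝ) : Matrix (Fin n) (Fin d) ℝ :=
  (rowSumDiag (W ⊙ G))⁻¹ * (W ⊙ G) * V

/-- `U₁ U₂ᵀ` is an `(ε, k)`-approximation of the nonnegative matrix `H`. -/
structure IsLowRankApprox {n k : ℕ} (ε : ℝ) (H : Matrix (Fin n) (Fin n) ℝ)
    (U₁ U₂ : Matrix (Fin n) (Fin k) ℝ) : Prop where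
  nonneg : ∀ i j, 0 ≤ (U₁ * U₂ᵀ) i j
  close : ∀ i j, |(U₁ * U₂ᵀ) i j - H i j| ≤ ε * H i j

/-- The order of magnitude of the degree parameter:
`max {log (1/ε) / log (log (1/ε) / B²), B²}`, where the first term is only meaningful (and is
only used) when `B² < log (1/ε)`. -/
noncomputable def degreeScale (ε B : ℝ) : ℝ :=
  if B ^ 2 < Real.log (1 / ε) then
    max (Real.log (1 / ε) / Real.log (Real.log (1 / ε) / B ^ 2)) (B ^ 2)
  else B ^ 2

/-! ### Masks -/

/-- A mask: a matrix with entries in `{0, 1}`. -/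
def IsMask {n : ℕ} (W : Matrix (Fin n) (Fin n) ℝ) : Prop :=
  ∀ i j, W i j = 0 ∨ W i j = 1

/-- The causal mask: `W i j = 1` iff `j ≤ i`. -/
def IsCausalMask {n : ℕ} (W : Matrix (Fin n) (Fin n) ℝ) : Prop :=
  ∀ i j, W i j = if j ≤ i then 1 else 0

/-- The row preceding row `j` of `W`; the row preceding the first one is zero. -/
def prevRow {n : ℕ} (W : Matrix (Fin n) (Fin n) ℝ) (j : Fin n) : Fin n → ℝ :=
  if (j : ℕ) = 0 then 0 else W ⟨j - 1, lt_of_le_of_lt (Nat.sub_le _ _) j.isLt⟩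

/-- Row change mask with bounds `b`: consecutive rows (starting from a zero row) satisfy
`‖W_j - W_{j-1}‖₁ ≤ b j`. -/
def IsRowChangeMask {n : ℕ} (W : Matrix (Fin n) (Fin n) ℝ) (b : Fin n → ℕ) : Prop :=
  ∀ j, ∑ l, |W j l - prevRow W j l| ≤ b j

/-- Continuous row mask with end points `s i`, `t i`. -/
def IsContinuousRowMask {n : ℕ} (W : Matrix (Fin n) (Fin n) ℝ) (s t : Fin n → Fin n) : Prop :=
  ∀ i j, W i j = if s i ≤ j ∧ j ≤ t i then 1 else 0

/-- The `r` sets `S j` are disjoint and cover `[n]`. -/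
def IsIndexPartition {n r : ℕ} (S : Fin r → Finset (Fin n)) : Prop :=
  Pairwise (fun j j' => Disjoint (S j) (S j')) ∧ ∀ i, ∃ j, i ∈ S j

/-- Distinct `r` columns mask: columns with indices in the same set `S j` are equal. -/
def IsDistinctColumnsMask {n r : ℕ} (W : Matrix (Fin n) (Fin n) ℝ)
    (S : Fin r → Finset (Fin n)) : Prop :=
  IsIndexPartition S ∧ ∀ j, ∀ i ∈ S j, ∀ i' ∈ S j, W.col i = W.col i'

/-- Distinct `r` rows mask: rows with indices in the same set `S j` are equal. -/
def IsDistinctRowsMask {n r : ℕ} (W : Matrix (Fin n) (Fin n) ℝ)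
    (S : Fin r → Finset (Fin n)) : Prop :=
  IsIndexPartition S ∧ ∀ j, ∀ i ∈ S j, ∀ i' ∈ S j, W.row i = W.row i'

/-! ### A real RAM with unit costs

A program is a finite text which does not depend on the input. The memory consists of registers
and of two-dimensional arrays, holding natural numbers (used as indices) or real numbers. Each
elementary operation and each evaluation of a test takes one step. Rounding, exponentials and
logarithms are not available, and the only integer operations are addition and truncated
subtraction. -/

/-- Memory contents: `natReg x` and `realReg x` are registers, `natArr a i j` and
`realArr a i j` are the entries at `(i, j)` of the array with name `a`. -/
structure State where
  natReg : ℕ → ℕ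
  realReg : ℕ → ℝ
  natArr : ℕ → ℕ → ℕ → ℕ
  realArr : ℕ → ℕ → ℕ → ℝ

/-- Overwrite one entry of one array. -/
def setEntry {α : Type} (m : ℕ → ℕ → ℕ → α) (a i j : ℕ) (v : α) : ℕ → ℕ → ℕ → α :=
  fun a' i' j' => if a' = a ∧ i' = i ∧ j' = j then v else m a' i' j'

/-- Elementary operations. The first register named is the target (for loads and arithmetic);
array indices are read from natural number registers. -/
inductive Instr where
  | natConst (x c : ℕ)
  | natCopy (x y : ℕ)
  | natAdd (x y z : ℕ)
  | natSub (x y z : ℕ)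
  | natLoad (x a i j : ℕ)
  | natStore (a i j x : ℕ)
  | realOfNat (x y : ℕ)
  | realCopy (x y : ℕ)
  | realAdd (x y z : ℕ)
  | realSub (x y z : ℕ)
  | realMul (x y z : ℕ)
  | realDiv (x y z : ℕ)
  | realLoad (x a i j : ℕ)
  | realStore (a i j x : ℕ)

namespace Instr

/-- Division by zero is not allowed: a program attempting it has no run. -/
def Defined : Instr → State → Prop
  | realDiv _ _ z, σ => σ.realReg z ≠ 0
  | _, _ => True

/-- The effect of an elementary operation. -/
noncomputable def apply : Instr → State → State
  | natConst x c, σ => { σ with natReg := Function.update σ.natReg x c }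
  | natCopy x y, σ => { σ with natReg := Function.update σ.natReg x (σ.natReg y) }
  | natAdd x y z, σ =>
      { σ with natReg := Function.update σ.natReg x (σ.natReg y + σ.natReg z) }
  | natSub x y z, σ =>
      { σ with natReg := Function.update σ.natReg x (σ.natReg y - σ.natReg z) }
  | natLoad x a i j, σ =>
      { σ with natReg := Function.update σ.natReg x (σ.natArr a (σ.natReg i) (σ.natReg j)) }
  | natStore a i j x, σ =>
      { σ with natArr := setEntry σ.natArr a (σ.natReg i) (σ.natReg j) (σ.natReg x) }
  | realOfNat x y, σ => { σ with realReg := Function.update σ.realReg x (σ.natReg y : ℝ) }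
  | realCopy x y, σ => { σ with realReg := Function.update σ.realReg x (σ.realReg y) }
  | realAdd x y z, σ =>
      { σ with realReg := Function.update σ.realReg x (σ.realReg y + σ.realReg z) }
  | realSub x y z, σ =>
      { σ with realReg := Function.update σ.realReg x (σ.realReg y - σ.realReg z) }
  | realMul x y z, σ =>
      { σ with realReg := Function.update σ.realReg x (σ.realReg y * σ.realReg z) }
  | realDiv x y z, σ =>
      { σ with realReg := Function.update σ.realReg x (σ.realReg y / σ.realReg z) }
  | realLoad x a i j, σ =>
      { σ with realReg := Function.update σ.realReg x (σ.realArr a (σ.natReg i) (σ.natReg j)) }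
  | realStore a i j x, σ =>
      { σ with realArr := setEntry σ.realArr a (σ.natReg i) (σ.natReg j) (σ.realReg x) }

end Instr

/-- Tests comparing two registers. -/
inductive Test where
  | natLt (x y : ℕ)
  | natEq (x y : ℕ)
  | realLt (x y : ℕ)

/-- The truth value of a test. -/
def Test.Holds : Test → State → Prop
  | natLt x y, σ => σ.natReg x < σ.natReg y
  | natEq x y, σ => σ.natReg x = σ.natReg y
  | realLt x y, σ => σ.realReg x < σ.realReg y

/-- Structured programs. -/
inductive Prog where
  | skip
  | instr (a : Instr)
  | seq (p q : Prog)
  | ite (c : Test) (p q : Prog)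
  | loop (c : Test) (p : Prog)

/-- `Exec p σ t τ`: started in `σ`, the program `p` halts in `τ` after `t` steps. The program
`loop c p` repeats `p` as long as `c` holds. -/
inductive Exec : Prog → State → ℕ → State → Prop
  | skip (σ : State) : Exec .skip σ 0 σ
  | instr (a : Instr) (σ : State) (h : a.Defined σ) : Exec (.instr a) σ 1 (a.apply σ)
  | seq {p q : Prog} {σ τ ρ : State} {t u : ℕ} (hp : Exec p σ t τ) (hq : Exec q τ u ρ) :
      Exec (.seq p q) σ (t + u) ρ
  | iteTrue {c : Test} {p q : Prog} {σ τ : State} {t : ℕ} (h : c.Holds σ) (hp : Exec p σ t τ) :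
      Exec (.ite c p q) σ (t + 1) τ
  | iteFalse {c : Test} {p q : Prog} {σ τ : State} {t : ℕ} (h : ¬ c.Holds σ)
      (hq : Exec q σ t τ) : Exec (.ite c p q) σ (t + 1) τ
  | loopTrue {c : Test} {p : Prog} {σ τ ρ : State} {t u : ℕ} (h : c.Holds σ)
      (hp : Exec p σ t τ) (hl : Exec (.loop c p) τ u ρ) : Exec (.loop c p) σ (t + u + 1) ρ
  | loopFalse {c : Test} {p : Prog} {σ : State} (h : ¬ c.Holds σ) : Exec (.loop c p) σ 1 σ

/-- Started in any memory satisfying `pre` (the input is in place, everything else is arbitrary),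
`p` halts after at most `T` steps, and `post` relates the initial and the final memory. -/
def RunsWithin (p : Prog) (pre : State → Prop) (post : State → State → Prop) (T : ℝ) : Prop :=
  ∀ σ, pre σ → ∃ t τ, Exec p σ t τ ∧ post σ τ ∧ (t : ℝ) ≤ T

/-! ### Input and output conventions

Natural number registers: `0 ↦ n`, `1 ↦ d`, `2 ↦ k`, `3 ↦ r`, `4 ↦ g`.
Real arrays: `0 ↦ Q`, `1 ↦ K`, `2 ↦ V`, `3 ↦ U₁`, `4 ↦ U₂`, `5 ↦` the output.
Natural number arrays `0` and `1`: the description of the mask. Indices start from `0`. -/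

/-- The array `A` contains the matrix `M`. -/
def HoldsMatrix {m n : ℕ} (A : ℕ → ℕ → ℝ) (M : Matrix (Fin m) (Fin n) ℝ) : Prop :=
  ∀ (i : Fin m) (j : Fin n), A i j = M i j

/-- The row `A` of an array contains a listing without repetition of the finite set `S`: first
the cardinality, then the elements, in any order. -/
def HoldsSet {n : ℕ} (A : ℕ → ℕ) (S : Finset (Fin n)) : Prop :=
  A 0 = S.card ∧
    (Finset.range S.card).image (fun m => A (m + 1)) = S.image (fun i : Fin n => (i : ℕ))

/-- The input of the program computing the two factors: `n`, `d`, `g`, `Q`, `K`. -/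
def FactorInput {n d : ℕ} (g : ℕ) (Q K : Matrix (Fin n) (Fin d) ℝ) (σ : State) : Prop :=
  σ.natReg 0 = n ∧ σ.natReg 1 = d ∧ σ.natReg 4 = g ∧
    HoldsMatrix (σ.realArr 0) Q ∧ HoldsMatrix (σ.realArr 1) K

/-- The output of the program computing the two factors: `k`, `U₁`, `U₂`; the sizes, the matrix
`V` and the description of the mask, which other programs use, are left unchanged. -/
def FactorOutput {n k : ℕ} (U₁ U₂ : Matrix (Fin n) (Fin k) ℝ) (σ τ : State) : Prop :=
  τ.natReg 2 = k ∧ HoldsMatrix (τ.realArr 3) U₁ ∧ HoldsMatrix (τ.realArr 4) U₂ ∧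
    τ.natReg 0 = σ.natReg 0 ∧ τ.natReg 1 = σ.natReg 1 ∧ τ.natReg 3 = σ.natReg 3 ∧
    τ.realArr 2 = σ.realArr 2 ∧ τ.natArr 0 = σ.natArr 0 ∧ τ.natArr 1 = σ.natArr 1

/-- The part of the input common to all masks: `n`, `d`, `k`, `U₁`, `U₂`, `V`. -/
def AttentionInput {n d k : ℕ} (U₁ U₂ : Matrix (Fin n) (Fin k) ℝ)
    (V : Matrix (Fin n) (Fin d) ℝ) (σ : State) : Prop :=
  σ.natReg 0 = n ∧ σ.natReg 1 = d ∧ σ.natReg 2 = k ∧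
    HoldsMatrix (σ.realArr 3) U₁ ∧ HoldsMatrix (σ.realArr 4) U₂ ∧ HoldsMatrix (σ.realArr 2) V

/-- The output: the matrix `Y`. -/
def AttentionOutput {n d : ℕ} (Y : Matrix (Fin n) (Fin d) ℝ) (_σ τ : State) : Prop :=
  HoldsMatrix (τ.realArr 5) Y

open Classical in
/-- The support of row `j` of `W` minus the support of the preceding row. -/
noncomputable def addedIndices {n : ℕ} (W : Matrix (Fin n) (Fin n) ℝ) (j : Fin n) :
    Finset (Fin n) :=
  {l | W j l = 1 ∧ prevRow W j l ≠ 1}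

open Classical in
/-- The support of the row preceding row `j` of `W` minus the support of row `j`. -/
noncomputable def removedIndices {n : ℕ} (W : Matrix (Fin n) (Fin n) ℝ) (j : Fin n) :
    Finset (Fin n) :=
  {l | W j l ≠ 1 ∧ prevRow W j l = 1}

/-- A row change mask is described by the lists of the changes from each row to the next. -/
def RowChangeInput {n : ℕ} (W : Matrix (Fin n) (Fin n) ℝ) (σ : State) : Prop :=
  ∀ j : Fin n, HoldsSet (σ.natArr 0 j) (addedIndices W j) ∧
    HoldsSet (σ.natArr 1 j) (removedIndices W j)

/-- A continuous row mask is described by the end points of its rows. -/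
def ContinuousRowInput {n : ℕ} (s t : Fin n → Fin n) (σ : State) : Prop :=
  ∀ i : Fin n, σ.natArr 0 i 0 = s i ∧ σ.natArr 0 i 1 = t i

/-- A mask with `r` distinct rows or columns is described by the number `r`, by the number `j` of
the set `S j` containing each index, and by its entries. -/
def DistinctInput {n r : ℕ} (W : Matrix (Fin n) (Fin n) ℝ) (S : Fin r → Finset (Fin n))
    (σ : State) : Prop :=
  σ.natReg 3 = r ∧ (∀ j, ∀ i ∈ S j, σ.natArr 0 (i : ℕ) 0 = (j : ℕ)) ∧
    ∀ i i' : Fin n, (σ.natArr 1 i i' : ℝ) = W i i'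

end MaskedAttention

open MaskedAttention

/-! Low rank. Every exponent `x = (Q Kᵀ) i j / d` satisfies `|x| ≤ B²`, so the Taylor polynomial of
degree `g` of `exp` has relative error at most `ε` once `g` is a constant multiple of the stated
maximum (`abs_taylor_sub_exp_le`, `degree_condition`). Expanded in the `d` summands of `x`, it is a
sum of `(g + d).choose g` monomials, each a function of `i` times a function of `j`; these are the
columns of `U₁` and `U₂`. The monomials, written with their variables in increasing order, form a
tree in which a child is its parent times one variable. A breadth-first traversal thus computes each
column in `O(n)` steps, hence all of them in `O(nk)`; `g` is given, so no logarithm is evaluated.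
Two quantities are preserved by each step of the traversal: the number of processed nodes plus the
sizes of the pending subtrees (`size_worklist`), and the corresponding sum of values
(`total_worklist`). The first gives the rank, the second the correctness.

Error. An entrywise relative error `ε` changes both the numerator and the denominator of a weighted
average by a relative `ε` at most, measured against the total weight
(`norm_maskedAttention_sub_le`).

Time. `W ⊙ (u u'ᵀ) = diag(u) W diag(u')`, so `W ⊙ (U₁ U₂ᵀ)` is applied to the columns of `V`, and to
a column of ones for the denominators, by `k (d + 1)` products of the mask with a vector
(`wp_attention`). Each kind of mask only has to supply a fast product: prefix sums, updates of a
running sum, differences of prefix sums, sums over classes of equal columns, or one product per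
class of equal rows.

Programs are verified with a weakest precondition calculus that also bounds the number of steps;
what a program leaves unchanged is read off its text (`Exec.frame`). -/

namespace MaskedAttention

/-! ### A weakest precondition calculus with time for the real RAM -/

/-- The parts of the memory an instruction can write to. -/
inductive Loc where
  | natReg (x : ℕ)
  | realReg (x : ℕ)
  | natArr (a : ℕ)
  | realArr (a : ℕ)

/-- The part of the memory an instruction writes to. -/
def Instr.target : Instr → Loc
  | natConst x _ => .natReg x
  | natCopy x _ => .natReg x
  | natAdd x _ _ => .natReg x
  | natSub x _ _ => .natReg x
  | natLoad x _ _ _ => .natReg x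
  | natStore a _ _ _ => .natArr a
  | realOfNat x _ => .realReg x
  | realCopy x _ => .realReg x
  | realAdd x _ _ => .realReg x
  | realSub x _ _ => .realReg x
  | realMul x _ _ => .realReg x
  | realDiv x _ _ => .realReg x
  | realLoad x _ _ _ => .realReg x
  | realStore a _ _ _ => .realArr a

/-- The program never writes to the given part of the memory. -/
def Prog.Keeps (l : Loc) : Prog → Prop
  | .skip => True
  | .instr a => a.target ≠ l
  | .seq p q => p.Keeps l ∧ q.Keeps l
  | .ite _ p q => p.Keeps l ∧ q.Keeps l
  | .loop _ p => p.Keeps l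

/-- The parts of the memory the program never writes to are the same in both states. -/
structure Frame (p : Prog) (σ τ : State) : Prop where
  natReg : ∀ x, p.Keeps (.natReg x) → τ.natReg x = σ.natReg x
  realReg : ∀ x, p.Keeps (.realReg x) → τ.realReg x = σ.realReg x
  natArr : ∀ a, p.Keeps (.natArr a) → τ.natArr a = σ.natArr a
  realArr : ∀ a, p.Keeps (.realArr a) → τ.realArr a = σ.realArr a

theorem Frame.refl (p : Prog) (σ : State) : Frame p σ σ :=
  ⟨fun _ _ => rfl, fun _ _ => rfl, fun _ _ => rfl, fun _ _ => rfl⟩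

theorem Frame.trans {p : Prog} {σ τ ρ : State} (h : Frame p σ τ) (h' : Frame p τ ρ) :
    Frame p σ ρ :=
  ⟨fun x hx => (h'.natReg x hx).trans (h.natReg x hx),
    fun x hx => (h'.realReg x hx).trans (h.realReg x hx),
    fun x hx => (h'.natArr x hx).trans (h.natArr x hx),
    fun x hx => (h'.realArr x hx).trans (h.realArr x hx)⟩

theorem Frame.mono {p q : Prog} {σ τ : State} (h : Frame p σ τ)
    (hpq : ∀ l, q.Keeps l → p.Keeps l) : Frame q σ τ :=
  ⟨fun x hx => h.natReg x (hpq _ hx), fun x hx => h.realReg x (hpq _ hx),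
    fun x hx => h.natArr x (hpq _ hx), fun x hx => h.realArr x (hpq _ hx)⟩

theorem frame_instr (a : Instr) (σ : State) : Frame (.instr a) σ (a.apply σ) := by
  constructor <;> intro x hx <;> cases a <;>
    simp only [Prog.Keeps, Instr.target, ne_eq, Loc.natReg.injEq, Loc.realReg.injEq,
      Loc.natArr.injEq, Loc.realArr.injEq, reduceCtorEq, not_false_eq_true] at hx <;>
    simp only [Instr.apply] <;>
    first
      | exact Function.update_of_ne (Ne.symm hx) _ _
      | (funext i j; simp [setEntry, Ne.symm hx])

/-- `Keeps` is a syntactic condition that `simp` decides for a concrete program, so loop invariants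
only need to mention the memory that changes. -/
theorem Exec.frame {p : Prog} {σ τ : State} {t : ℕ} (h : Exec p σ t τ) : Frame p σ τ := by
  induction h with
  | skip σ => exact Frame.refl _ _
  | instr a σ h => exact frame_instr a σ
  | seq hp hq ihp ihq =>
    exact Frame.trans (ihp.mono fun l hl => And.left hl) (ihq.mono fun l hl => And.right hl)
  | iteTrue h hp ih => exact ih.mono fun l hl => And.left hl
  | iteFalse h hp ih => exact ih.mono fun l hl => And.right hl
  | loopTrue h hp hl ihp ihl => exact Frame.trans (p := .loop _ _) (ihp.mono fun l hl => hl) ihl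
  | loopFalse h => exact Frame.refl _ _

/-- Started in `σ`, the program halts, and its running time and final state satisfy `Q`. -/
def WP (p : Prog) (σ : State) (Q : ℕ → State → Prop) : Prop :=
  ∃ t τ, Exec p σ t τ ∧ Q t τ

/-- The frame is supplied for free, so specifications of subprograms need not list what they
preserve. -/
theorem WP.mono {p : Prog} {σ : State} {Q Q' : ℕ → State → Prop} (h : WP p σ Q)
    (hQ : ∀ t τ, Frame p σ τ → Q t τ → Q' t τ) : WP p σ Q' := by
  obtain ⟨t, τ, he, hq⟩ := h
  exact ⟨t, τ, he, hQ t τ he.frame hq⟩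

@[simp] theorem wp_skip {σ : State} {Q : ℕ → State → Prop} : WP .skip σ Q ↔ Q 0 σ := by
  constructor
  · rintro ⟨t, τ, he, hq⟩
    cases he
    exact hq
  · exact fun h => ⟨0, σ, .skip σ, h⟩

@[simp] theorem wp_instr {a : Instr} {σ : State} {Q : ℕ → State → Prop} :
    WP (.instr a) σ Q ↔ a.Defined σ ∧ Q 1 (a.apply σ) := by
  constructor
  · rintro ⟨t, τ, he, hq⟩
    cases he with
    | instr _ _ h => exact ⟨h, hq⟩
  · exact fun h => ⟨1, _, .instr a σ h.1, h.2⟩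

@[simp] theorem wp_seq {p q : Prog} {σ : State} {Q : ℕ → State → Prop} :
    WP (.seq p q) σ Q ↔ WP p σ fun t τ => WP q τ fun u ρ => Q (t + u) ρ := by
  constructor
  · rintro ⟨t, τ, he, hq⟩
    cases he with
    | seq hp hq' => exact ⟨_, _, hp, _, _, hq', hq⟩
  · rintro ⟨t, τ, hp, u, ρ, hq', hq⟩
    exact ⟨_, _, .seq hp hq', hq⟩

theorem wp_ite {c : Test} {p q : Prog} {σ : State} {Q : ℕ → State → Prop}
    (ht : c.Holds σ → WP p σ fun t τ => Q (t + 1) τ)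
    (hf : ¬ c.Holds σ → WP q σ fun t τ => Q (t + 1) τ) : WP (.ite c p q) σ Q := by
  by_cases h : c.Holds σ
  · obtain ⟨t, τ, he, hq⟩ := ht h
    exact ⟨_, _, .iteTrue h he, hq⟩
  · obtain ⟨t, τ, he, hq⟩ := hf h
    exact ⟨_, _, .iteFalse h he, hq⟩

/-- A loop whose body is executed `N` times, the `j`-th time in at most `c j` steps. -/
theorem wp_loop {b : Test} {p : Prog} {σ : State} {Q : ℕ → State → Prop} (N : ℕ) (c : ℕ → ℕ)
    (Inv : ℕ → State → Prop) (h0 : Inv 0 σ)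
    (hstep : ∀ j < N, ∀ τ, Frame p σ τ → Inv j τ →
      b.Holds τ ∧ WP p τ fun t τ' => t ≤ c j ∧ Inv (j + 1) τ')
    (hN : ∀ t τ, t ≤ ∑ j ∈ Finset.range N, (c j + 1) + 1 → Frame p σ τ → Inv N τ →
      ¬ b.Holds τ ∧ Q t τ) :
    WP (.loop b p) σ Q := by
  -- Induction on the number `m` of remaining iterations, because `Exec.loopTrue` peels off the
  -- first one.
  have key : ∀ m ≤ N, ∀ τ, Frame p σ τ → Inv (N - m) τ → ∃ t ρ, Exec (.loop b p) τ t ρ ∧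
      t ≤ ∑ j ∈ Finset.Ico (N - m) N, (c j + 1) + 1 ∧ Frame p σ ρ ∧ Inv N ρ := by
    intro m
    induction m with
    | zero =>
      intro _ τ hF hI
      exact ⟨1, τ, .loopFalse (hN 0 τ (Nat.zero_le _) hF hI).1, by simp, hF, hI⟩
    | succ m ih =>
      intro hm τ hF hI
      obtain ⟨hb, t, τ', he, ht, hI'⟩ := hstep (N - (m + 1)) (by omega) τ hF hI
      have hs : N - (m + 1) + 1 = N - m := by omega
      rw [hs] at hI'
      obtain ⟨u, ρ, he', hu, hF', hI''⟩ := ih (by omega) τ' (hF.trans he.frame) hI'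
      refine ⟨_, ρ, .loopTrue hb he he', ?_, hF', hI''⟩
      rw [Finset.sum_eq_sum_Ico_succ_bot (by omega : N - (m + 1) < N), hs]
      omega
  obtain ⟨t, ρ, he, ht, hF, hI⟩ := key N le_rfl σ (Frame.refl _ _) (by simpa using h0)
  rw [Nat.sub_self, Nat.Ico_zero_eq_range] at ht
  exact ⟨t, ρ, he, (hN t ρ ht hF hI).2⟩

/-! ### Blocks of instructions and counting loops -/

/-- Execute a list of instructions. -/
def Prog.block : List Instr → Prog
  | [] => .skip
  | a :: l => .seq (.instr a) (block l)

/-- Overwrite a natural number register. -/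
def State.setNat (σ : State) (x v : ℕ) : State :=
  { σ with natReg := Function.update σ.natReg x v }

/-- `for i = 0, …, m - 1 do p`, where `m` is the contents of register `m`. Register `6` is used
for the increment. -/
def Prog.for (i m : ℕ) (p : Prog) : Prog :=
  .seq (.instr (.natConst i 0)) (.loop (.natLt i m)
    (.seq p (.seq (.instr (.natConst 6 1)) (.instr (.natAdd i i 6)))))

@[simp] theorem Prog.keeps_skip (l : Loc) : Prog.skip.Keeps l ↔ True := Iff.rfl

@[simp] theorem Prog.keeps_instr (l : Loc) (a : Instr) :
    (Prog.instr a).Keeps l ↔ a.target ≠ l := Iff.rfl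

@[simp] theorem Prog.keeps_seq (l : Loc) (p q : Prog) :
    (Prog.seq p q).Keeps l ↔ p.Keeps l ∧ q.Keeps l := Iff.rfl

@[simp] theorem Prog.keeps_ite (l : Loc) (c : Test) (p q : Prog) :
    (Prog.ite c p q).Keeps l ↔ p.Keeps l ∧ q.Keeps l := Iff.rfl

@[simp] theorem Prog.keeps_loop (l : Loc) (c : Test) (p : Prog) :
    (Prog.loop c p).Keeps l ↔ p.Keeps l := Iff.rfl

@[simp] theorem Prog.keeps_block (l : Loc) (s : List Instr) :
    (Prog.block s).Keeps l ↔ ∀ a ∈ s, a.target ≠ l := by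
  induction s with
  | nil => simp [Prog.block]
  | cons a s ih => simp [Prog.block, ih]

@[simp] theorem Prog.keeps_for (l : Loc) (i m : ℕ) (p : Prog) :
    (Prog.for i m p).Keeps l ↔ p.Keeps l ∧ Loc.natReg i ≠ l ∧ Loc.natReg 6 ≠ l := by
  simp only [Prog.for, Prog.keeps_seq, Prog.keeps_instr, Prog.keeps_loop, Instr.target]
  tauto

attribute [simp] Instr.target Instr.Defined Instr.apply setEntry

@[simp] theorem wp_block_nil {σ : State} {Q : ℕ → State → Prop} :
    WP (.block []) σ Q ↔ Q 0 σ := wp_skip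

@[simp] theorem wp_block_cons {a : Instr} {s : List Instr} {σ : State}
    {Q : ℕ → State → Prop} : WP (.block (a :: s)) σ Q ↔
      a.Defined σ ∧ WP (.block s) (a.apply σ) fun t τ => Q (1 + t) τ := by
  rw [Prog.block, wp_seq, wp_instr]

@[simp] theorem State.setNat_natReg (σ : State) (x v : ℕ) :
    (σ.setNat x v).natReg = Function.update σ.natReg x v := rfl

@[simp] theorem State.setNat_realReg (σ : State) (x v : ℕ) :
    (σ.setNat x v).realReg = σ.realReg := rfl

@[simp] theorem State.setNat_natArr (σ : State) (x v : ℕ) :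
    (σ.setNat x v).natArr = σ.natArr := rfl

@[simp] theorem State.setNat_realArr (σ : State) (x v : ℕ) :
    (σ.setNat x v).realArr = σ.realArr := rfl

/-- Besides its body, an iteration pays for the test, the constant `1` and the increment, hence `c j
+ 3`; the final `2` is the initialization and the failing test. The invariant is required after the
increment, which overwrites registers `6` and `i`. -/
theorem wp_for {i m : ℕ} {p : Prog} {σ : State} {Q : ℕ → State → Prop} (N : ℕ) (c : ℕ → ℕ)
    (Inv : ℕ → State → Prop) (hm : σ.natReg m = N)
    (hregs : m ≠ i ∧ m ≠ 6 ∧ i ≠ 6 ∧ p.Keeps (.natReg m) ∧ p.Keeps (.natReg i))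
    (h0 : Inv 0 (σ.setNat i 0))
    (hstep : ∀ j < N, ∀ τ, Frame (.for i m p) σ τ → τ.natReg i = j → Inv j τ →
      WP p τ fun t τ' => t ≤ c j ∧ Inv (j + 1) ((τ'.setNat 6 1).setNat i (j + 1)))
    (hQ : ∀ t τ, t ≤ ∑ j ∈ Finset.range N, (c j + 3) + 2 → Frame (.for i m p) σ τ →
      Inv N τ → Q t τ) :
    WP (.for i m p) σ Q := by
  obtain ⟨hmi, hm6, hi6, hkm, hki⟩ := hregs
  rw [Prog.for, wp_seq, wp_instr]
  refine ⟨trivial, ?_⟩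
  have hF0 : Frame (.for i m p) σ (σ.setNat i 0) :=
    (frame_instr (.natConst i 0) σ).mono fun l hl => by simp_all
  refine wp_loop N (fun j => c j + 2) (fun j τ => τ.natReg i = j ∧ Inv j τ) ⟨by simp, h0⟩ ?_ ?_
  · rintro j hj τ hF ⟨hi, hI⟩
    have hF' : Frame (.for i m p) σ τ := hF0.trans (hF.mono fun l hl => by simp_all)
    have hN : τ.natReg m = N := by rw [hF'.natReg m (by simp [*, Ne.symm]), hm]
    refine ⟨by simpa [Test.Holds, hi, hN], ?_⟩
    rw [wp_seq]
    refine (hstep j hj τ hF' hi hI).mono ?_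
    rintro t τ' hF'' ⟨ht, hI'⟩
    have hi' : τ'.natReg i = j := by rw [hF''.natReg i hki, hi]
    simp only [wp_seq, wp_instr, Instr.Defined, true_and, Instr.apply]
    refine ⟨by omega, by simp [hi6, hi'], ?_⟩
    have : (τ'.setNat 6 1).setNat i (j + 1) = { τ' with
        natReg := Function.update (Function.update τ'.natReg 6 1) i
          (Function.update τ'.natReg 6 1 i + Function.update τ'.natReg 6 1 6) } := by
      simp [State.setNat, hi6, hi']
    rwa [← this]
  · rintro t τ ht hF ⟨hi, hI⟩
    have hF' : Frame (.for i m p) σ τ := hF0.trans (hF.mono fun l hl => by simp_all)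
    have hN : τ.natReg m = N := by rw [hF'.natReg m (by simp [*, Ne.symm]), hm]
    refine ⟨by simp [Test.Holds, hi, hN], hQ _ τ ?_ hF' hI⟩
    have : ∑ j ∈ Finset.range N, (c j + 2 + 1) = ∑ j ∈ Finset.range N, (c j + 3) := rfl
    omega

theorem wp_for_const {i m : ℕ} {p : Prog} {σ : State} {Q : ℕ → State → Prop} (N c : ℕ)
    (Inv : ℕ → State → Prop) (hm : σ.natReg m = N)
    (hregs : m ≠ i ∧ m ≠ 6 ∧ i ≠ 6 ∧ p.Keeps (.natReg m) ∧ p.Keeps (.natReg i))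
    (h0 : Inv 0 (σ.setNat i 0))
    (hstep : ∀ j < N, ∀ τ, Frame (.for i m p) σ τ → τ.natReg i = j → Inv j τ →
      WP p τ fun t τ' => t ≤ c ∧ Inv (j + 1) ((τ'.setNat 6 1).setNat i (j + 1)))
    (hQ : ∀ t τ, t ≤ N * (c + 3) + 2 → Frame (.for i m p) σ τ → Inv N τ → Q t τ) :
    WP (.for i m p) σ Q :=
  wp_for N (fun _ => c) Inv hm hregs h0 hstep fun t τ ht => hQ t τ (by simpa using ht)

/-! ### Programs multiplying a mask by a vector

The vector is row `0` of the real array `8`, the product is stored in row `0` of the real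
array `9`. The number register `5` and the real register `0` contain zero. Only registers from
`10` on and real arrays from `8` on are overwritten. -/

/-- The part of the memory these programs rely on. -/
structure Ready (n : ℕ) (σ : State) : Prop where
  size : σ.natReg 0 = n
  natZero : σ.natReg 5 = 0
  realZero : σ.realReg 0 = 0

theorem Ready.of_frame {n : ℕ} {p : Prog} {σ τ : State} (h : Ready n σ) (hF : Frame p σ τ)
    (h0 : p.Keeps (.natReg 0)) (h5 : p.Keeps (.natReg 5)) (hz : p.Keeps (.realReg 0)) :
    Ready n τ :=
  ⟨(hF.natReg 0 h0).trans h.size, (hF.natReg 5 h5).trans h.natZero,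
    (hF.realReg 0 hz).trans h.realZero⟩

/-- Multiply the causal mask by a vector. -/
def mulVecCausal : Prog :=
  .seq (.block [.realCopy 10 0])
    (.for 20 0 (.block [.realLoad 11 8 5 20, .realAdd 10 10 11, .realStore 9 5 20 10]))

/-- The entries of the product are prefix sums, each obtained from the preceding one by one
addition. -/
theorem wp_mulVecCausal {n : ℕ} {σ : State} (h : Ready n σ) :
    WP mulVecCausal σ fun t τ => t ≤ 6 * n + 3 ∧
      ∀ i < n, τ.realArr 9 0 i = ∑ j ∈ Finset.range (i + 1), σ.realArr 8 0 j := by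
  rw [mulVecCausal]
  simp only [wp_seq, wp_block_cons, wp_block_nil, Instr.Defined, true_and, Instr.apply]
  refine wp_for_const n 3 (fun m τ => τ.realReg 10 = ∑ j ∈ Finset.range m, σ.realArr 8 0 j ∧
    ∀ i < m, τ.realArr 9 0 i = ∑ j ∈ Finset.range (i + 1), σ.realArr 8 0 j) (by simp [h.size])
    (by simp) (by simp [h.realZero]) ?_ ?_
  · rintro m hm τ hF hi ⟨hacc, hy⟩
    have h5 : τ.natReg 5 = 0 := by rw [hF.natReg 5 (by simp)]; exact h.natZero
    have h8 : τ.realArr 8 = σ.realArr 8 := by rw [hF.realArr 8 (by simp)]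
    simp only [wp_block_cons, wp_block_nil]
    simp [h5, h8, hi, hacc, Finset.sum_range_succ]
    intro i hi
    split_ifs with h
    · rw [h]
    · rw [hy i (by omega), Finset.sum_range_succ]
  · rintro t τ ht hF ⟨hacc, hy⟩
    exact ⟨by omega, hy⟩

/-- Add (or subtract, according to `op`) to the real register `10` the entries of the vector
listed in the row of the number array `a` given by register `20`. -/
def accumulateListed (a : ℕ) (op : Instr) : Prog :=
  .seq (.block [.natLoad 21 a 20 5]) (.for 22 21 (.block
    [.natConst 24 1, .natAdd 23 22 24, .natLoad 25 a 20 23, .realLoad 11 8 5 25, op]))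

/-- The sign `s` lets one proof serve both the added and the removed indices. -/
theorem wp_accumulateListed {a : ℕ} {op : Instr} {s : ℝ}
    (hop : op = .realAdd 10 10 11 ∧ s = 1 ∨ op = .realSub 10 10 11 ∧ s = -1)
    {i : ℕ} {σ : State} (h5 : σ.natReg 5 = 0) (hi : σ.natReg 20 = i) :
    WP (accumulateListed a op) σ fun t τ => t ≤ 8 * σ.natArr a i 0 + 3 ∧
      τ.realReg 10 = σ.realReg 10 +
        s * ∑ m ∈ Finset.range (σ.natArr a i 0), σ.realArr 8 0 (σ.natArr a i (m + 1)) := by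
  rw [accumulateListed]
  simp only [wp_seq, wp_block_cons, wp_block_nil, Instr.Defined, true_and, Instr.apply]
  refine wp_for_const (σ.natArr a i 0) 5 (fun l τ => τ.realReg 10 = σ.realReg 10 +
      s * ∑ m ∈ Finset.range l, σ.realArr 8 0 (σ.natArr a i (m + 1))) (by simp [h5, hi])
    ?_ (by simp) ?_ ?_
  · rcases hop with ⟨rfl, _⟩ | ⟨rfl, _⟩ <;> simp
  · rintro l hl τ hF hli hacc
    rcases hop with ⟨rfl, rfl⟩ | ⟨rfl, rfl⟩
    all_goals
      have h5' : τ.natReg 5 = 0 := by rw [hF.natReg 5 (by simp)]; simpa using h5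
      have hi' : τ.natReg 20 = i := by rw [hF.natReg 20 (by simp)]; simpa using hi
      have h8 : τ.realArr 8 = σ.realArr 8 := by rw [hF.realArr 8 (by simp)]
      have ha : τ.natArr a = σ.natArr a := by rw [hF.natArr a (by simp)]
      simp only [wp_block_cons, wp_block_nil]
      simp [h5', h8, hi', hli, ha, hacc, Finset.sum_range_succ]
      ring
  · rintro t τ ht hF hacc
    exact ⟨by omega, hacc⟩

/-- Multiply a row change mask by a vector. -/
def mulVecRowChange : Prog :=
  .seq (.block [.realCopy 10 0]) (.for 20 0
    (.seq (accumulateListed 0 (.realAdd 10 10 11))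
      (.seq (accumulateListed 1 (.realSub 10 10 11)) (.block [.realStore 9 5 20 10]))))

/-- Real register `10` is never reset between rows, so it accumulates the changes of all rows so
far; the cost is governed by the total length of the lists. -/
theorem wp_mulVecRowChange {n : ℕ} {σ : State} (h : Ready n σ) :
    WP mulVecRowChange σ fun t τ =>
      t ≤ 10 * n + 8 * ∑ i ∈ Finset.range n, (σ.natArr 0 i 0 + σ.natArr 1 i 0) + 3 ∧
      ∀ i < n, τ.realArr 9 0 i = ∑ j ∈ Finset.range (i + 1),
        (∑ m ∈ Finset.range (σ.natArr 0 j 0), σ.realArr 8 0 (σ.natArr 0 j (m + 1)) -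
          ∑ m ∈ Finset.range (σ.natArr 1 j 0), σ.realArr 8 0 (σ.natArr 1 j (m + 1))) := by
  rw [mulVecRowChange]
  simp only [wp_seq, wp_block_cons, wp_block_nil, Instr.Defined, true_and, Instr.apply]
  set f : ℕ → ℝ := fun j =>
    ∑ m ∈ Finset.range (σ.natArr 0 j 0), σ.realArr 8 0 (σ.natArr 0 j (m + 1)) -
      ∑ m ∈ Finset.range (σ.natArr 1 j 0), σ.realArr 8 0 (σ.natArr 1 j (m + 1)) with hf
  refine wp_for n (fun i => 8 * (σ.natArr 0 i 0 + σ.natArr 1 i 0) + 7)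
    (fun m τ => τ.realReg 10 = ∑ j ∈ Finset.range m, f j ∧
      ∀ i < m, τ.realArr 9 0 i = ∑ j ∈ Finset.range (i + 1), f j) (by simp [h.size])
    (by simp [accumulateListed]) (by simp [h.realZero]) ?_ ?_
  · rintro m hm τ hF hi ⟨hacc, hy⟩
    have h5 : τ.natReg 5 = 0 := by
      rw [hF.natReg 5 (by simp [accumulateListed])]; exact h.natZero
    have h8 : τ.realArr 8 = σ.realArr 8 := by rw [hF.realArr 8 (by simp [accumulateListed])]
    have h0 : τ.natArr 0 = σ.natArr 0 := by rw [hF.natArr 0 (by simp [accumulateListed])]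
    have h1 : τ.natArr 1 = σ.natArr 1 := by rw [hF.natArr 1 (by simp [accumulateListed])]
    rw [wp_seq]
    refine (wp_accumulateListed (s := 1) (.inl ⟨rfl, rfl⟩) h5 hi).mono ?_
    rintro t₁ τ₁ hF₁ ⟨ht₁, hacc₁⟩
    rw [wp_seq]
    refine (wp_accumulateListed (s := -1) (i := m) (.inr ⟨rfl, rfl⟩) ?_ ?_).mono ?_
    · rw [hF₁.natReg 5 (by simp [accumulateListed]), h5]
    · rw [hF₁.natReg 20 (by simp [accumulateListed]), hi]
    rintro t₂ τ₂ hF₂ ⟨ht₂, hacc₂⟩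
    have h5' : τ₂.natReg 5 = 0 := by
      rw [hF₂.natReg 5 (by simp [accumulateListed]), hF₁.natReg 5 (by simp [accumulateListed]),
        h5]
    have hi' : τ₂.natReg 20 = m := by
      rw [hF₂.natReg 20 (by simp [accumulateListed]),
        hF₁.natReg 20 (by simp [accumulateListed]), hi]
    have h9' : τ₂.realArr 9 = τ.realArr 9 := by
      rw [hF₂.realArr 9 (by simp [accumulateListed]),
        hF₁.realArr 9 (by simp [accumulateListed])]
    have h8' : τ₁.realArr 8 = σ.realArr 8 := by
      rw [hF₁.realArr 8 (by simp [accumulateListed]), h8]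
    have h1' : τ₁.natArr 1 = σ.natArr 1 := by
      rw [hF₁.natArr 1 (by simp [accumulateListed]), h1]
    have hr : τ₂.realReg 10 = ∑ j ∈ Finset.range (m + 1), f j := by
      rw [hacc₂, hacc₁, hacc, h8, h8', h0, h1', Finset.sum_range_succ, hf]
      ring
    rw [h0] at ht₁
    rw [h1'] at ht₂
    simp only [wp_block_cons, wp_block_nil]
    simp only [Instr.Defined, Instr.apply, true_and, State.setNat_realReg,
      State.setNat_realArr, hr]
    refine ⟨by omega, fun i hi => ?_⟩
    simp only [setEntry, h5', hi', true_and]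
    split_ifs with h
    · rw [h]
    · rw [h9', hy i (by omega)]
  · rintro t τ ht hF ⟨hacc, hy⟩
    refine ⟨?_, hy⟩
    simp only [Finset.sum_add_distrib, ← Finset.mul_sum, Finset.sum_const, Finset.card_range,
      smul_eq_mul] at ht ⊢
    omega

/-- Multiply a continuous row mask by a vector. -/
def mulVecContinuous : Prog :=
  .seq (.block [.realCopy 10 0, .natConst 24 1])
    (.seq
      (.for 20 0 (.block [.realStore 10 5 20 10, .realLoad 11 8 5 20, .realAdd 10 10 11,
        .realStore 11 5 20 10]))
      (.for 20 0 (.block [.natLoad 21 0 20 5, .natLoad 22 0 20 24, .realLoad 10 10 5 21,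
        .realLoad 11 11 5 22, .realSub 11 11 10, .realStore 9 5 20 11])))

/-- Prefix sums are tabulated excluding (array `10`) and including (array `11`) the current index; a
sum over an interval is then one subtraction of two entries at indices below `n`. The time is
linear, without a logarithm. -/
theorem wp_mulVecContinuous {n : ℕ} {σ : State} (h : Ready n σ)
    (hn : ∀ i < n, σ.natArr 0 i 0 < n ∧ σ.natArr 0 i 1 < n) :
    WP mulVecContinuous σ fun t τ => t ≤ 16 * n + 6 ∧
      ∀ i < n, τ.realArr 9 0 i =
        ∑ j ∈ Finset.range (σ.natArr 0 i 1 + 1), σ.realArr 8 0 j -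
          ∑ j ∈ Finset.range (σ.natArr 0 i 0), σ.realArr 8 0 j := by
  rw [mulVecContinuous]
  simp only [wp_seq, wp_block_cons, wp_block_nil, Instr.Defined, true_and, Instr.apply]
  refine wp_for_const n 4 (fun m τ => τ.realReg 10 = ∑ j ∈ Finset.range m, σ.realArr 8 0 j ∧
    ∀ i < m, τ.realArr 10 0 i = ∑ j ∈ Finset.range i, σ.realArr 8 0 j ∧
      τ.realArr 11 0 i = ∑ j ∈ Finset.range (i + 1), σ.realArr 8 0 j) (by simp [h.size])
    (by simp) (by simp [h.realZero]) ?_ ?_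
  · rintro m hm τ hF hi ⟨hacc, hy⟩
    have h5 : τ.natReg 5 = 0 := by rw [hF.natReg 5 (by simp)]; simpa using h.natZero
    have h8 : τ.realArr 8 = σ.realArr 8 := by rw [hF.realArr 8 (by simp)]
    simp only [wp_block_cons, wp_block_nil]
    simp [h5, h8, hi, hacc, Finset.sum_range_succ]
    intro i hi
    split_ifs with h
    · rw [h]; simp
    · rw [(hy i (by omega)).1, (hy i (by omega)).2, Finset.sum_range_succ]; simp
  · rintro t τ ht hF ⟨hacc, hy⟩
    have h24 : τ.natReg 24 = 1 := by rw [hF.natReg 24 (by simp)]; simp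
    refine wp_for_const n 6 (fun m τ => ∀ i < m, τ.realArr 9 0 i =
        ∑ j ∈ Finset.range (σ.natArr 0 i 1 + 1), σ.realArr 8 0 j -
          ∑ j ∈ Finset.range (σ.natArr 0 i 0), σ.realArr 8 0 j) ?_ (by simp) (by simp) ?_ ?_
    · rw [hF.natReg 0 (by simp)]; simp [h.size]
    · rintro m hm τ' hF' hi hz
      have h5 : τ'.natReg 5 = 0 := by
        rw [hF'.natReg 5 (by simp), hF.natReg 5 (by simp)]; simpa using h.natZero
      have h24' : τ'.natReg 24 = 1 := by rw [hF'.natReg 24 (by simp), h24]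
      have h0 : τ'.natArr 0 = σ.natArr 0 := by
        rw [hF'.natArr 0 (by simp), hF.natArr 0 (by simp)]
      have h10 : τ'.realArr 10 = τ.realArr 10 := by rw [hF'.realArr 10 (by simp)]
      have h11 : τ'.realArr 11 = τ.realArr 11 := by rw [hF'.realArr 11 (by simp)]
      obtain ⟨hs, hts⟩ := hn m hm
      simp only [wp_block_cons, wp_block_nil]
      simp [h5, h24', h0, h10, h11, hi, (hy _ hs).1, (hy _ hts).2]
      intro i hi
      split_ifs with h
      · rw [h]
      · rw [hz i (by omega)]
    · rintro t' τ' ht' hF' hz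
      exact ⟨by omega, hz⟩

/-- Multiply a mask with few distinct columns by a vector. -/
def mulVecColumns : Prog :=
  .seq (.for 20 3 (.block [.realStore 10 5 20 0]))
    (.seq
      (.for 20 0 (.block [.natLoad 21 0 20 5, .realLoad 10 10 5 21, .realLoad 11 8 5 20,
        .realAdd 10 10 11, .realStore 10 5 21 10, .natStore 2 5 21 20]))
      (.for 20 0 (.seq (.block [.realCopy 10 0])
        (.seq
          (.for 22 3 (.block [.natLoad 23 2 5 22, .natLoad 24 1 20 23, .realOfNat 11 24,
            .realLoad 12 10 5 22, .realMul 11 11 12, .realAdd 10 10 11]))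
          (.block [.realStore 9 5 20 10])))))

theorem wp_mulVecColumns {n r : ℕ} {σ : State} (h : Ready n σ) (hr : σ.natReg 3 = r)
    (hlab : ∀ i < n, σ.natArr 0 i 0 < r)
    (hcol : ∀ j < n, ∀ j' < n, σ.natArr 0 j 0 = σ.natArr 0 j' 0 →
      ∀ i < n, σ.natArr 1 i j = σ.natArr 1 i j') :
    WP mulVecColumns σ fun t τ => t ≤ 9 * (n * r) + 20 * n + 4 * r + 6 ∧
      ∀ i < n, τ.realArr 9 0 i =
        ∑ j ∈ Finset.range n, (σ.natArr 1 i j : ℝ) * σ.realArr 8 0 j := by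
  rw [mulVecColumns, wp_seq]
  refine wp_for_const r 1 (fun m τ => ∀ i < m, τ.realArr 10 0 i = 0) hr (by simp) (by simp) ?_ ?_
  · rintro m hm τ hF hi hz
    have h5 : τ.natReg 5 = 0 := by rw [hF.natReg 5 (by simp)]; simpa using h.natZero
    have hz0 : τ.realReg 0 = 0 := by rw [hF.realReg 0 (by simp)]; simpa using h.realZero
    simp only [wp_block_cons, wp_block_nil]
    simp [h5, hz0, hi]
    intro i hi hne
    exact hz i (by omega)
  rintro t₁ τ₁ ht₁ hF₁ hz
  have hR₁ : Ready n τ₁ := h.of_frame hF₁ (by simp) (by simp) (by simp)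
  have hr₁ : τ₁.natReg 3 = r := by rw [hF₁.natReg 3 (by simp), hr]
  have h0₁ : τ₁.natArr 0 = σ.natArr 0 := hF₁.natArr 0 (by simp)
  have h1₁ : τ₁.natArr 1 = σ.natArr 1 := hF₁.natArr 1 (by simp)
  have h8₁ : τ₁.realArr 8 = σ.realArr 8 := hF₁.realArr 8 (by simp)
  rw [wp_seq]
  -- Array `10` holds the sum of the vector over each class; number array `2` holds the last index
  -- met in each class, as its representative.
  refine wp_for_const n 6 (fun m τ => (∀ l < r, τ.realArr 10 0 l =
      ∑ j ∈ Finset.range m, if σ.natArr 0 j 0 = l then σ.realArr 8 0 j else 0) ∧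
    ∀ i < m, τ.natArr 2 0 (σ.natArr 0 i 0) < n ∧
      σ.natArr 0 (τ.natArr 2 0 (σ.natArr 0 i 0)) 0 = σ.natArr 0 i 0) hR₁.size (by simp)
    ⟨by simpa using hz, by simp⟩ ?_ ?_
  · rintro m hm τ hF hi ⟨hz, hrep⟩
    have h5 : τ.natReg 5 = 0 := by rw [hF.natReg 5 (by simp)]; exact hR₁.natZero
    have h0 : τ.natArr 0 = σ.natArr 0 := by rw [hF.natArr 0 (by simp), h0₁]
    have h8 : τ.realArr 8 = σ.realArr 8 := by rw [hF.realArr 8 (by simp), h8₁]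
    simp only [wp_block_cons, wp_block_nil]
    simp [h5, h0, h8, hi]
    refine ⟨fun l hl => ?_, fun i hi => ?_⟩
    · rw [Finset.sum_range_succ, ← hz l hl]
      by_cases hlm : l = σ.natArr 0 m 0
      · simp [hlm]
      · simp [hlm, Ne.symm hlm]
    · by_cases him : σ.natArr 0 i 0 = σ.natArr 0 m 0
      · simp [him, hm]
      · have : i ≠ m := fun h => him (by rw [h])
        simpa [him] using hrep i (by omega)
  rintro t₂ τ₂ ht₂ hF₂ ⟨hz₂, hrep⟩
  have hR₂ : Ready n τ₂ := hR₁.of_frame hF₂ (by simp) (by simp) (by simp)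
  have hr₂ : τ₂.natReg 3 = r := by rw [hF₂.natReg 3 (by simp), hr₁]
  have h1₂ : τ₂.natArr 1 = σ.natArr 1 := by rw [hF₂.natArr 1 (by simp), h1₁]
  -- A label carried by no index has class sum `0`, so the arbitrary value stored as its
  -- representative is harmless.
  have hsum : ∀ i < n, ∑ l ∈ Finset.range r, (σ.natArr 1 i (τ₂.natArr 2 0 l) : ℝ) *
      τ₂.realArr 10 0 l = ∑ j ∈ Finset.range n, (σ.natArr 1 i j : ℝ) * σ.realArr 8 0 j := by
    intro i hi
    calc _ = ∑ l ∈ Finset.range r, ∑ j ∈ Finset.range n, (if σ.natArr 0 j 0 = l then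
          (σ.natArr 1 i (τ₂.natArr 2 0 l) : ℝ) * σ.realArr 8 0 j else 0) := by
          refine Finset.sum_congr rfl fun l hl => ?_
          rw [hz₂ l (Finset.mem_range.1 hl), Finset.mul_sum]
          simp
      _ = _ := by
          rw [Finset.sum_comm]
          refine Finset.sum_congr rfl fun j hj => ?_
          have hj := Finset.mem_range.1 hj
          rw [Finset.sum_ite_eq, if_pos (Finset.mem_range.2 (hlab j hj)),
            hcol _ (hrep j hj).1 j hj (hrep j hj).2 i hi]
  refine wp_for_const n (9 * r + 4) (fun m τ => ∀ i < m, τ.realArr 9 0 i =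
    ∑ j ∈ Finset.range n, (σ.natArr 1 i j : ℝ) * σ.realArr 8 0 j) hR₂.size (by simp)
    (by simp) ?_ ?_
  · rintro m hm τ hF hi hy
    have hR : Ready n τ := hR₂.of_frame hF (by simp) (by simp) (by simp)
    have h1 : τ.natArr 1 = σ.natArr 1 := by rw [hF.natArr 1 (by simp), h1₂]
    have h2 : τ.natArr 2 = τ₂.natArr 2 := hF.natArr 2 (by simp)
    have h10 : τ.realArr 10 = τ₂.realArr 10 := hF.realArr 10 (by simp)
    have h3 : τ.natReg 3 = r := by rw [hF.natReg 3 (by simp), hr₂]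
    simp only [wp_seq, wp_block_cons, wp_block_nil]
    refine ⟨trivial, wp_for_const r 6 (fun l τ => τ.realReg 10 = ∑ l ∈ Finset.range l,
      (σ.natArr 1 m (τ₂.natArr 2 0 l) : ℝ) * τ₂.realArr 10 0 l) h3 (by simp)
      (by simp [hR.realZero]) ?_ ?_⟩
    · rintro l hl τ' hF' hl' hacc
      have h5' : τ'.natReg 5 = 0 := by rw [hF'.natReg 5 (by simp)]; exact hR.natZero
      have hi' : τ'.natReg 20 = m := by rw [hF'.natReg 20 (by simp)]; exact hi
      have h1' : τ'.natArr 1 = σ.natArr 1 := by rw [hF'.natArr 1 (by simp)]; exact h1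
      have h2' : τ'.natArr 2 = τ₂.natArr 2 := by rw [hF'.natArr 2 (by simp)]; exact h2
      have h10' : τ'.realArr 10 = τ₂.realArr 10 := by
        rw [hF'.realArr 10 (by simp)]; exact h10
      simp only [wp_block_cons, wp_block_nil]
      simp [h5', hi', h1', h2', h10', hl', hacc, Finset.sum_range_succ]
    · rintro t τ' ht hF' hacc
      rw [hsum m hm] at hacc
      have h5' : τ'.natReg 5 = 0 := by rw [hF'.natReg 5 (by simp)]; exact hR.natZero
      have hi' : τ'.natReg 20 = m := by rw [hF'.natReg 20 (by simp)]; exact hi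
      have h9' : τ'.realArr 9 = τ.realArr 9 := hF'.realArr 9 (by simp)
      simp [h5', hi', hacc, h9']
      refine ⟨by omega, fun i hi => ?_⟩
      split_ifs with hh
      · rw [hh]
      · exact hy i (by omega)
  · rintro t τ ht hF hy
    refine ⟨?_, hy⟩
    have : n * (9 * r + 4 + 3) = 9 * (n * r) + 7 * n := by ring
    omega

/-- Multiply a mask with few distinct rows by a vector. -/
def mulVecRows : Prog :=
  .seq (.for 20 0 (.block [.natLoad 21 0 20 5, .natStore 2 5 21 20]))
    (.seq
      (.for 20 3 (.seq (.block [.realCopy 10 0, .natLoad 23 2 5 20])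
        (.seq
          (.for 22 0 (.block [.natLoad 24 1 23 22, .realOfNat 11 24,
            .realLoad 12 8 5 22, .realMul 11 11 12, .realAdd 10 10 11]))
          (.block [.realStore 10 5 20 10]))))
      (.for 20 0 (.block [.natLoad 21 0 20 5, .realLoad 10 10 5 21, .realStore 9 5 20 10])))

theorem wp_mulVecRows {n r : ℕ} {σ : State} (h : Ready n σ) (hr : σ.natReg 3 = r)
    (hlab : ∀ i < n, σ.natArr 0 i 0 < r)
    (hrow : ∀ j < n, ∀ j' < n, σ.natArr 0 j 0 = σ.natArr 0 j' 0 →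
      ∀ i < n, σ.natArr 1 j i = σ.natArr 1 j' i) :
    WP mulVecRows σ fun t τ => t ≤ 8 * (n * r) + 11 * n + 8 * r + 6 ∧
      ∀ i < n, τ.realArr 9 0 i =
        ∑ j ∈ Finset.range n, (σ.natArr 1 i j : ℝ) * σ.realArr 8 0 j := by
  rw [mulVecRows, wp_seq]
  refine wp_for_const n 2 (fun m τ => ∀ i < m, τ.natArr 2 0 (σ.natArr 0 i 0) < n ∧
      σ.natArr 0 (τ.natArr 2 0 (σ.natArr 0 i 0)) 0 = σ.natArr 0 i 0) h.size (by simp)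
    (by simp) ?_ ?_
  · rintro m hm τ hF hi hrep
    have h5 : τ.natReg 5 = 0 := by rw [hF.natReg 5 (by simp)]; exact h.natZero
    have h0 : τ.natArr 0 = σ.natArr 0 := hF.natArr 0 (by simp)
    simp only [wp_block_cons, wp_block_nil]
    simp [h5, h0, hi]
    intro i hi
    by_cases him : σ.natArr 0 i 0 = σ.natArr 0 m 0
    · simp [him, hm]
    · have : i ≠ m := fun h => him (by rw [h])
      simpa [him] using hrep i (by omega)
  rintro t₁ τ₁ ht₁ hF₁ hrep
  have hR₁ : Ready n τ₁ := h.of_frame hF₁ (by simp) (by simp) (by simp)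
  have hr₁ : τ₁.natReg 3 = r := by rw [hF₁.natReg 3 (by simp), hr]
  have h0₁ : τ₁.natArr 0 = σ.natArr 0 := hF₁.natArr 0 (by simp)
  have h1₁ : τ₁.natArr 1 = σ.natArr 1 := hF₁.natArr 1 (by simp)
  have h8₁ : τ₁.realArr 8 = σ.realArr 8 := hF₁.realArr 8 (by simp)
  rw [wp_seq]
  -- One product per label, with the row of its representative. For an unused label this row is
  -- arbitrary, but the result is never read.
  refine wp_for_const r (8 * n + 5) (fun m τ => ∀ l < m, τ.realArr 10 0 l =
    ∑ j ∈ Finset.range n, (σ.natArr 1 (τ₁.natArr 2 0 l) j : ℝ) * σ.realArr 8 0 j) hr₁ (by simp)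
    (by simp) ?_ ?_
  · rintro m hm τ hF hi hy
    have hR : Ready n τ := hR₁.of_frame hF (by simp) (by simp) (by simp)
    have h1 : τ.natArr 1 = σ.natArr 1 := by rw [hF.natArr 1 (by simp), h1₁]
    have h2 : τ.natArr 2 = τ₁.natArr 2 := hF.natArr 2 (by simp)
    have h8 : τ.realArr 8 = σ.realArr 8 := by rw [hF.realArr 8 (by simp), h8₁]
    simp only [wp_seq, wp_block_cons, wp_block_nil]
    refine ⟨trivial, trivial, wp_for_const n 5 (fun l τ => τ.realReg 10 = ∑ j ∈ Finset.range l,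
      (σ.natArr 1 (τ₁.natArr 2 0 m) j : ℝ) * σ.realArr 8 0 j) (by simp [hR.size]) (by simp)
      (by simp [hR.realZero]) ?_ ?_⟩
    · rintro l hl τ' hF' hl' hacc
      have h5' : τ'.natReg 5 = 0 := by rw [hF'.natReg 5 (by simp)]; simpa using hR.natZero
      have h23' : τ'.natReg 23 = τ₁.natArr 2 0 m := by
        rw [hF'.natReg 23 (by simp)]; simp [hR.natZero, hi, h2]
      have h1' : τ'.natArr 1 = σ.natArr 1 := by rw [hF'.natArr 1 (by simp)]; exact h1
      have h8' : τ'.realArr 8 = σ.realArr 8 := by rw [hF'.realArr 8 (by simp)]; exact h8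
      simp only [wp_block_cons, wp_block_nil]
      simp [h5', h23', h1', h8', hl', hacc, Finset.sum_range_succ]
    · rintro t τ' ht hF' hacc
      have h5' : τ'.natReg 5 = 0 := by rw [hF'.natReg 5 (by simp)]; simpa using hR.natZero
      have hi' : τ'.natReg 20 = m := by rw [hF'.natReg 20 (by simp)]; simpa using hi
      have h10' : τ'.realArr 10 = τ.realArr 10 := hF'.realArr 10 (by simp)
      simp [h5', hi', hacc, h10']
      refine ⟨by omega, fun i hi => ?_⟩
      split_ifs with hh
      · rw [hh]
      · exact hy i (by omega)
  rintro t₂ τ₂ ht₂ hF₂ hw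
  have hR₂ : Ready n τ₂ := hR₁.of_frame hF₂ (by simp) (by simp) (by simp)
  have h0₂ : τ₂.natArr 0 = σ.natArr 0 := by rw [hF₂.natArr 0 (by simp), h0₁]
  refine wp_for_const n 3 (fun m τ => ∀ i < m, τ.realArr 9 0 i =
    ∑ j ∈ Finset.range n, (σ.natArr 1 i j : ℝ) * σ.realArr 8 0 j) hR₂.size (by simp)
    (by simp) ?_ ?_
  · rintro m hm τ hF hi hy
    have h5 : τ.natReg 5 = 0 := by rw [hF.natReg 5 (by simp)]; exact hR₂.natZero
    have h0 : τ.natArr 0 = σ.natArr 0 := by rw [hF.natArr 0 (by simp), h0₂]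
    have h10 : τ.realArr 10 = τ₂.realArr 10 := hF.realArr 10 (by simp)
    simp only [wp_block_cons, wp_block_nil]
    simp [h5, h0, h10, hi, hw _ (hlab m hm)]
    intro i hi
    split_ifs with hh
    · subst hh
      refine Finset.sum_congr rfl fun j hj => ?_
      rw [hrow _ (hrep i hm).1 i hm (hrep i hm).2 j (Finset.mem_range.1 hj)]
    · exact hy i (by omega)
  · rintro t τ ht hF hy
    refine ⟨?_, hy⟩
    have : r * (8 * n + 5 + 3) = 8 * (n * r) + 8 * r := by ring
    omega

/-! ### From products of the mask with vectors to masked attention -/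

/-- The parts of the memory a program for multiplying the mask by a vector must not touch. -/
structure Prog.Safe (p : Prog) : Prop where
  natReg : ∀ x < 20, x ≠ 6 → p.Keeps (.natReg x)
  realReg : ∀ x < 10, p.Keeps (.realReg x)
  natArr : ∀ a < 2, p.Keeps (.natArr a)
  realArr : ∀ a < 9, p.Keeps (.realArr a)

theorem safe_mulVecCausal : mulVecCausal.Safe := by
  constructor <;> intro x hx <;> simp [mulVecCausal] <;> omega

theorem safe_mulVecRowChange : mulVecRowChange.Safe := by
  constructor <;> intro x hx <;> simp [mulVecRowChange, accumulateListed] <;> omega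

theorem safe_mulVecContinuous : mulVecContinuous.Safe := by
  constructor <;> intro x hx <;> simp [mulVecContinuous] <;> omega

theorem safe_mulVecColumns : mulVecColumns.Safe := by
  constructor <;> intro x hx <;> simp [mulVecColumns] <;> omega

theorem safe_mulVecRows : mulVecRows.Safe := by
  constructor <;> intro x hx <;> simp [mulVecRows] <;> omega

/-- Add the contribution of the column of the factors given by register `10` to the column given
by register `9` of the unnormalized output, which is the real array `7`. -/
def addColumn (mv : Prog) : Prog :=
  .seq
    (.for 8 0 (.block [.realLoad 2 4 8 10, .realLoad 3 2 8 9, .realMul 2 2 3,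
      .realStore 8 5 8 2]))
    (.seq mv
      (.for 8 0 (.block [.realLoad 2 3 8 10, .realLoad 3 9 5 8, .realMul 2 2 3,
        .realLoad 3 7 8 9, .realAdd 2 2 3, .realStore 7 8 9 2])))

/-- Compute masked attention, using a program multiplying the mask by a vector. A column of ones
is appended to `V`, to obtain the row sums as an additional column of the unnormalized output. -/
def attention (mv : Prog) : Prog :=
  .seq (.block [.natConst 5 0, .realOfNat 0 5, .natConst 7 1, .realOfNat 1 7, .natAdd 7 1 7])
    (.seq (.for 8 0 (.block [.realStore 2 8 1 1]))
      (.seq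
        (.for 9 7 (.seq (.for 8 0 (.block [.realStore 7 8 9 0])) (.for 10 2 (addColumn mv))))
        (.for 8 0 (.for 9 1 (.block [.realLoad 2 7 8 9, .realLoad 3 7 8 1, .realDiv 2 2 3,
          .realStore 5 8 9 2])))))

/-- In states agreeing with `σ` on the description of the mask, the program multiplies the
matrix `w` by a vector in at most `T` steps. -/
def MulVecSpec (mv : Prog) (n T : ℕ) (w : ℕ → ℕ → ℝ) (σ : State) : Prop :=
  ∀ τ, Ready n τ → τ.natReg 3 = σ.natReg 3 → τ.natArr 0 = σ.natArr 0 →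
    τ.natArr 1 = σ.natArr 1 → WP mv τ fun t ρ => t ≤ T ∧
      ∀ i < n, ρ.realArr 9 0 i = ∑ j ∈ Finset.range n, w i j * τ.realArr 8 0 j

theorem MulVecSpec.of_frame {mv p : Prog} {n T : ℕ} {w : ℕ → ℕ → ℝ} {σ τ : State}
    (h : MulVecSpec mv n T w σ) (hF : Frame p σ τ) (h3 : p.Keeps (.natReg 3))
    (h0 : p.Keeps (.natArr 0)) (h1 : p.Keeps (.natArr 1)) : MulVecSpec mv n T w τ :=
  fun ρ hR h3' h0' h1' => h ρ hR (h3'.trans (hF.natReg 3 h3)) (h0'.trans (hF.natArr 0 h0))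
    (h1'.trans (hF.natArr 1 h1))

/-- This is `(w ⊙ (u u'ᵀ)) v = u ⊙ (w (u' ⊙ v))`: scale the vector, multiply by the mask, scale the
result. -/
theorem wp_addColumn {mv : Prog} (hk : mv.Safe) {n T : ℕ} {w : ℕ → ℕ → ℝ} {σ : State}
    (h : Ready n σ) (hmv : MulVecSpec mv n T w σ) {c l : ℕ} (hc : σ.natReg 9 = c)
    (hl : σ.natReg 10 = l) :
    WP (addColumn mv) σ fun t τ => t ≤ 16 * n + T + 4 ∧
      (∀ i c', c' ≠ c → τ.realArr 7 i c' = σ.realArr 7 i c') ∧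
      ∀ i < n, τ.realArr 7 i c = σ.realArr 7 i c + σ.realArr 3 i l *
        ∑ j ∈ Finset.range n, w i j * (σ.realArr 4 j l * σ.realArr 2 j c) := by
  have hkN := hk.natReg
  have hkR := hk.realReg
  have hkA := hk.realArr
  rw [addColumn, wp_seq]
  refine wp_for_const n 4 (fun m τ => ∀ j < m, τ.realArr 8 0 j =
    σ.realArr 4 j l * σ.realArr 2 j c) h.size (by simp) (by simp) ?_ ?_
  · rintro m hm τ hF hi hx
    have h5 : τ.natReg 5 = 0 := by rw [hF.natReg 5 (by simp)]; exact h.natZero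
    have h9 : τ.natReg 9 = c := by rw [hF.natReg 9 (by simp), hc]
    have h10 : τ.natReg 10 = l := by rw [hF.natReg 10 (by simp), hl]
    have h2 : τ.realArr 2 = σ.realArr 2 := hF.realArr 2 (by simp)
    have h4 : τ.realArr 4 = σ.realArr 4 := hF.realArr 4 (by simp)
    simp only [wp_block_cons, wp_block_nil]
    simp [h5, h9, h10, h2, h4, hi]
    intro i hi
    split_ifs with hh
    · rw [hh]
    · exact hx i (by omega)
  rintro t₁ τ₁ ht₁ hF₁ hx
  rw [wp_seq]
  have hR₁ : Ready n τ₁ := h.of_frame hF₁ (by simp) (by simp) (by simp)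
  refine (hmv τ₁ hR₁ (hF₁.natReg 3 (by simp)) (hF₁.natArr 0 (by simp))
    (hF₁.natArr 1 (by simp))).mono ?_
  rintro t₂ τ₂ hF₂ ⟨ht₂, hy⟩
  have hR₂ : Ready n τ₂ := hR₁.of_frame hF₂ (by simp [hkN]) (by simp [hkN]) (by simp [hkR])
  have hy' : ∀ i < n, τ₂.realArr 9 0 i =
      ∑ j ∈ Finset.range n, w i j * (σ.realArr 4 j l * σ.realArr 2 j c) := by
    intro i hi
    rw [hy i hi]
    exact Finset.sum_congr rfl fun j hj => by rw [hx j (Finset.mem_range.1 hj)]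
  have h9₂ : τ₂.natReg 9 = c := by
    rw [hF₂.natReg 9 (by simp [hkN]), hF₁.natReg 9 (by simp), hc]
  have h10₂ : τ₂.natReg 10 = l := by
    rw [hF₂.natReg 10 (by simp [hkN]), hF₁.natReg 10 (by simp), hl]
  have h3₂ : τ₂.realArr 3 = σ.realArr 3 := by
    rw [hF₂.realArr 3 (by simp [hkA]), hF₁.realArr 3 (by simp)]
  have h7₂ : τ₂.realArr 7 = σ.realArr 7 := by
    rw [hF₂.realArr 7 (by simp [hkA]), hF₁.realArr 7 (by simp)]
  refine wp_for_const n 6 (fun m τ => (∀ i c', c' ≠ c → τ.realArr 7 i c' = σ.realArr 7 i c') ∧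
    (∀ i ≥ m, τ.realArr 7 i c = σ.realArr 7 i c) ∧
    ∀ i < m, τ.realArr 7 i c = σ.realArr 7 i c + σ.realArr 3 i l *
      ∑ j ∈ Finset.range n, w i j * (σ.realArr 4 j l * σ.realArr 2 j c)) hR₂.size (by simp)
    (by simp [h7₂]) ?_ ?_
  · rintro m hm τ hF hi ⟨hz₁, hz₂, hz₃⟩
    have h5 : τ.natReg 5 = 0 := by rw [hF.natReg 5 (by simp)]; exact hR₂.natZero
    have h9 : τ.natReg 9 = c := by rw [hF.natReg 9 (by simp), h9₂]
    have h10 : τ.natReg 10 = l := by rw [hF.natReg 10 (by simp), h10₂]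
    have h3 : τ.realArr 3 = σ.realArr 3 := by rw [hF.realArr 3 (by simp), h3₂]
    have ha9 : τ.realArr 9 = τ₂.realArr 9 := hF.realArr 9 (by simp)
    simp only [wp_block_cons, wp_block_nil]
    simp [h5, h9, h10, h3, ha9, hi]
    refine ⟨fun i c' hc' => ?_, fun i hi => ?_, fun i hi => ?_⟩
    · simp [hc', hz₁ i c' hc']
    · rw [if_neg (by omega), hz₂ i (by omega)]
    · split_ifs with hh
      · rw [hh, hy' m hm, hz₂ m le_rfl, add_comm]
      · exact hz₃ i (by omega)
  · rintro t τ ht hF ⟨hz₁, -, hz₃⟩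
    exact ⟨by omega, hz₁, hz₃⟩

theorem wp_attention {mv : Prog} (hk : mv.Safe) {n d k T : ℕ} {w : ℕ → ℕ → ℝ} {σ : State}
    (hn : σ.natReg 0 = n) (hd : σ.natReg 1 = d) (hkk : σ.natReg 2 = k)
    (hmv : MulVecSpec mv n T w σ)
    (hden : ∀ i < n, ∑ l ∈ Finset.range k, σ.realArr 3 i l *
      ∑ j ∈ Finset.range n, w i j * σ.realArr 4 j l ≠ 0) :
    WP (attention mv) σ fun t τ =>
      t ≤ (d + 1) * (4 * n + 7 + k * (16 * n + T + 7)) + n * (7 * d + 9) + 11 ∧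
      ∀ i < n, ∀ c < d, τ.realArr 5 i c =
        (∑ l ∈ Finset.range k, σ.realArr 3 i l *
          ∑ j ∈ Finset.range n, w i j * (σ.realArr 4 j l * σ.realArr 2 j c)) /
        ∑ l ∈ Finset.range k, σ.realArr 3 i l *
          ∑ j ∈ Finset.range n, w i j * σ.realArr 4 j l := by
  have hkN := hk.natReg
  have hkR := hk.realReg
  have hkA := hk.realArr
  have hkB := hk.natArr
  rw [attention, wp_seq]
  simp only [wp_block_cons, wp_block_nil, Instr.Defined, true_and, Instr.apply]
  rw [wp_seq]
  refine wp_for_const n 1 (fun m τ => (∀ j, ∀ c < d, τ.realArr 2 j c = σ.realArr 2 j c) ∧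
    ∀ j < m, τ.realArr 2 j d = 1) (by simp [hn]) (by simp) (by simp) ?_ ?_
  · rintro m hm τ hF hi ⟨hv, hone⟩
    have h1 : τ.natReg 1 = d := by rw [hF.natReg 1 (by simp)]; simp [hd]
    have h1' : τ.realReg 1 = 1 := by rw [hF.realReg 1 (by simp)]; simp
    simp only [wp_block_cons, wp_block_nil]
    simp [h1, h1', hi]
    refine ⟨fun j c hc => ?_, fun j hj hne => hone j (by omega)⟩
    rw [if_neg (by omega), hv j c hc]
  rintro t₁ τ₁ ht₁ hF₁ ⟨hv₁, hone₁⟩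
  have hR₁ : Ready n τ₁ :=
    ⟨by rw [hF₁.natReg 0 (by simp)]; simp [hn], by rw [hF₁.natReg 5 (by simp)]; simp,
      by rw [hF₁.realReg 0 (by simp)]; simp⟩
  have h1₁ : τ₁.natReg 1 = d := by rw [hF₁.natReg 1 (by simp)]; simp [hd]
  have h2₁ : τ₁.natReg 2 = k := by rw [hF₁.natReg 2 (by simp)]; simp [hkk]
  have h3₁ : τ₁.natReg 3 = σ.natReg 3 := by rw [hF₁.natReg 3 (by simp)]; simp
  have h7₁ : τ₁.natReg 7 = d + 1 := by rw [hF₁.natReg 7 (by simp)]; simp [hd]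
  have hA₁ : ∀ a, a ≠ 2 → τ₁.realArr a = σ.realArr a := fun a ha => by
    rw [hF₁.realArr a (by simp [ha.symm])]
  have hB₁ : ∀ a, τ₁.natArr a = σ.natArr a := fun a => by rw [hF₁.natArr a (by simp)]
  have hmv₁ : MulVecSpec mv n T w τ₁ := fun τ hR h3 h0 h1 =>
    hmv τ hR (h3.trans h3₁) (h0.trans (hB₁ 0)) (h1.trans (hB₁ 1))
  -- The first argument counts the columns of the factors already added. `τ₁` has ones in column `d`
  -- of array `2`, so `Z k i d` is the denominator of row `i`.
  set Z : ℕ → ℕ → ℕ → ℝ := fun k i c => ∑ l ∈ Finset.range k, σ.realArr 3 i l *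
    ∑ j ∈ Finset.range n, w i j * (σ.realArr 4 j l * τ₁.realArr 2 j c) with hZ
  rw [wp_seq]
  refine wp_for_const (d + 1) (4 * n + 4 + k * (16 * n + T + 7))
    (fun m τ => ∀ c < m, ∀ i < n, τ.realArr 7 i c = Z k i c) h7₁
    (by simp [addColumn, hkN]) (by simp) ?_ ?_
  · rintro c hc τ hF hi hz
    have hR : Ready n τ := hR₁.of_frame hF (by simp [addColumn, hkN])
      (by simp [addColumn, hkN]) (by simp [addColumn, hkR])
    rw [wp_seq]
    refine wp_for_const n 1 (fun m τ' => (∀ c' < c, ∀ i < n, τ'.realArr 7 i c' = Z k i c') ∧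
      ∀ i < m, τ'.realArr 7 i c = 0) hR.size (by simp) (by simpa using hz) ?_ ?_
    · rintro m hm τ' hF' hi' ⟨hz', hzero⟩
      have h9' : τ'.natReg 9 = c := by rw [hF'.natReg 9 (by simp), hi]
      have h0' : τ'.realReg 0 = 0 := by rw [hF'.realReg 0 (by simp)]; exact hR.realZero
      simp only [wp_block_cons, wp_block_nil]
      simp [h9', h0', hi']
      refine ⟨fun c' hc' i hi => ?_, fun i hi hne => hzero i (by omega)⟩
      rw [if_neg (by omega), hz' c' hc' i hi]
    rintro t₂ τ₂ ht₂ hF₂ ⟨hz₂, hzero⟩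
    have hR₂ : Ready n τ₂ := hR.of_frame hF₂ (by simp) (by simp) (by simp)
    have h2₂ : τ₂.natReg 2 = k := by
      rw [hF₂.natReg 2 (by simp), hF.natReg 2 (by simp [addColumn, hkN]), h2₁]
    have h9₂ : τ₂.natReg 9 = c := by rw [hF₂.natReg 9 (by simp), hi]
    have ha2₂ : τ₂.realArr 2 = τ₁.realArr 2 := by
      rw [hF₂.realArr 2 (by simp), hF.realArr 2 (by simp [addColumn, hkA])]
    have ha3₂ : τ₂.realArr 3 = σ.realArr 3 := by
      rw [hF₂.realArr 3 (by simp), hF.realArr 3 (by simp [addColumn, hkA]), hA₁ 3 (by simp)]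
    have ha4₂ : τ₂.realArr 4 = σ.realArr 4 := by
      rw [hF₂.realArr 4 (by simp), hF.realArr 4 (by simp [addColumn, hkA]), hA₁ 4 (by simp)]
    have hmv₂ : MulVecSpec mv n T w τ₂ :=
      (hmv₁.of_frame hF (by simp [addColumn, hkN]) (by simp [addColumn, hkB])
        (by simp [addColumn, hkB])).of_frame hF₂ (by simp) (by simp) (by simp)
    refine wp_for_const k (16 * n + T + 4)
      (fun m τ' => (∀ c' < c, ∀ i < n, τ'.realArr 7 i c' = Z k i c') ∧
        ∀ i < n, τ'.realArr 7 i c = Z m i c) h2₂ (by simp [addColumn, hkN])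
      ⟨hz₂, by simpa [hZ] using hzero⟩ ?_ ?_
    · rintro l hl τ' hF' hl' ⟨hz', hacc⟩
      have hR' : Ready n τ' := hR₂.of_frame hF' (by simp [addColumn, hkN])
        (by simp [addColumn, hkN]) (by simp [addColumn, hkR])
      refine (wp_addColumn hk hR' (hmv₂.of_frame hF' (by simp [addColumn, hkN])
        (by simp [addColumn, hkB]) (by simp [addColumn, hkB])) (c := c) ?_ hl').mono ?_
      · rw [hF'.natReg 9 (by simp [addColumn, hkN]), h9₂]
      rintro t τ'' hF'' ⟨ht, hother, hnew⟩
      refine ⟨ht, fun c' hc' i hi => ?_, fun i hi => ?_⟩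
      · rw [← hz' c' hc' i hi]
        exact hother i c' (by omega)
      · rw [hZ]
        simp only [State.setNat_realArr, Finset.sum_range_succ]
        rw [hnew i hi, hacc i hi, hF'.realArr 3 (by simp [addColumn, hkA]),
          hF'.realArr 4 (by simp [addColumn, hkA]), hF'.realArr 2 (by simp [addColumn, hkA]),
          ha2₂, ha3₂, ha4₂]
    · rintro t τ' ht hF' ⟨hz', hacc⟩
      have : k * (16 * n + T + 4 + 3) = k * (16 * n + T + 7) := rfl
      refine ⟨by omega, fun c' hc' i hin => ?_⟩
      rcases Nat.lt_succ_iff_lt_or_eq.1 hc' with h | rfl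
      · exact hz' c' h i hin
      · exact hacc i hin
  rintro t₂ τ₂ ht₂ hF₂ hz
  have hR₂ : Ready n τ₂ := hR₁.of_frame hF₂ (by simp [addColumn, hkN])
      (by simp [addColumn, hkN]) (by simp [addColumn, hkR])
  have h1₂ : τ₂.natReg 1 = d := by rw [hF₂.natReg 1 (by simp [addColumn, hkN]), h1₁]
  have hZd : ∀ i, Z k i d = ∑ l ∈ Finset.range k, σ.realArr 3 i l *
      ∑ j ∈ Finset.range n, w i j * σ.realArr 4 j l := by
    intro i
    refine Finset.sum_congr rfl fun l _ => congrArg _ (Finset.sum_congr rfl fun j hj => ?_)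
    rw [hone₁ j (Finset.mem_range.1 hj), mul_one]
  have hZc : ∀ i, ∀ c < d, Z k i c = ∑ l ∈ Finset.range k, σ.realArr 3 i l *
      ∑ j ∈ Finset.range n, w i j * (σ.realArr 4 j l * σ.realArr 2 j c) := by
    intro i c hc
    refine Finset.sum_congr rfl fun l _ => congrArg _ (Finset.sum_congr rfl fun j _ => ?_)
    rw [hv₁ j c hc]
  refine wp_for_const n (7 * d + 2)
    (fun m τ => ∀ i < m, ∀ c < d, τ.realArr 5 i c = Z k i c / Z k i d) hR₂.size (by simp)
    (by simp) ?_ ?_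
  · rintro m hm τ hF hi hy
    have h1 : τ.natReg 1 = d := by rw [hF.natReg 1 (by simp), h1₂]
    have h7 : τ.realArr 7 = τ₂.realArr 7 := hF.realArr 7 (by simp)
    refine wp_for_const d 4 (fun m' τ' =>
      (∀ i < m, ∀ c < d, τ'.realArr 5 i c = Z k i c / Z k i d) ∧
      ∀ c < m', τ'.realArr 5 m c = Z k m c / Z k m d) h1 (by simp) (by simpa using hy) ?_ ?_
    · rintro c hc τ' hF' hc' ⟨hy₁, hy₂⟩
      have h8' : τ'.natReg 8 = m := by rw [hF'.natReg 8 (by simp), hi]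
      have h1' : τ'.natReg 1 = d := by rw [hF'.natReg 1 (by simp), h1]
      have h7' : τ'.realArr 7 = τ₂.realArr 7 := by rw [hF'.realArr 7 (by simp), h7]
      have hne : Z k m d ≠ 0 := by rw [hZd]; exact hden m hm
      simp only [wp_block_cons, wp_block_nil]
      simp [h8', h1', h7', hc', hz d (by omega) m hm, hz c (by omega) m hm, hne]
      refine ⟨fun i hi c hc => ?_, fun c hc => ?_⟩
      · rw [if_neg (by omega), hy₁ i hi c hc]
      · split_ifs with hh
        · rw [hh]
        · exact hy₂ c (by omega)
    · rintro t τ' ht hF' ⟨hy₁, hy₂⟩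
      refine ⟨by omega, fun i hi c hc => ?_⟩
      rcases Nat.lt_succ_iff_lt_or_eq.1 hi with h | rfl
      · exact hy₁ i h c hc
      · exact hy₂ c hc
  · rintro t τ ht hF hy
    refine ⟨?_, fun i hi c hc => ?_⟩
    · have h₁ : (d + 1) * (4 * n + 4 + k * (16 * n + T + 7) + 3) =
        (d + 1) * (4 * n + 7 + k * (16 * n + T + 7)) := by ring
      have h₂ : n * (7 * d + 2 + 3) + 4 * n = n * (7 * d + 9) := by ring
      omega
    · rw [hy i hi c hc, hZd, hZc i c hc]

/-! ### Approximation of the exponential by Taylor polynomials -/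

/-- For `N ≥ 2M` the remainder is at most `2 |x|^N / N!`, and `N^N / N! ≤ exp N` turns `M^N / N!`
into `exp (-(N (log (N / M) - 1)))`. Of the exponent `L + M + 1`, the part `L` is the accuracy, `M`
pays for `exp x ≥ exp (-M)`, and `1` for the factor `2 ≤ e`. -/
theorem abs_taylor_sub_exp_le {M L x : ℝ} {N : ℕ} (hM : 0 < M) (hN : 2 * M ≤ N)
    (hNL : L + M + 1 ≤ N * (Real.log (N / M) - 1)) (hx : |x| ≤ M) :
    |∑ m ∈ Finset.range N, x ^ m / m.factorial - Real.exp x| ≤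
      Real.exp (-L) * Real.exp x := by
  have hN0 : (0 : ℝ) < N := by linarith
  have h₁ : |∑ m ∈ Finset.range N, x ^ m / m.factorial - Real.exp x| ≤
      |x| ^ N / N.factorial * 2 := by
    have h := Complex.exp_bound' (x := (x : ℂ)) (n := N) (by
      rw [Complex.norm_real, Real.norm_eq_abs, div_le_iff₀ (by positivity)]
      push_cast
      linarith)
    rw [Complex.norm_real, Real.norm_eq_abs, norm_sub_rev] at h
    rw [← Real.norm_eq_abs, ← Complex.norm_real]
    push_cast
    exact h
  have h₂ : |x| ^ N / N.factorial ≤ Real.exp (-(N * (Real.log (N / M) - 1))) := by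
    calc |x| ^ N / N.factorial ≤ M ^ N / N.factorial := by gcongr
      _ = (M / N) ^ N * ((N : ℝ) ^ N / N.factorial) := by
          rw [div_pow]
          field_simp
      _ ≤ (M / N) ^ N * Real.exp N := by
          gcongr
          exact Real.pow_div_factorial_le_exp _ hN0.le N
      _ = Real.exp (-(N * (Real.log (N / M) - 1))) := by
          have : M / N = Real.exp (-Real.log (N / M)) := by
            rw [Real.exp_neg, Real.exp_log (by positivity), inv_div]
          rw [this, ← Real.exp_nat_mul, ← Real.exp_add]
          ring_nf
  calc _ ≤ |x| ^ N / N.factorial * 2 := h₁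
    _ ≤ Real.exp (-(L + M + 1)) * Real.exp 1 := by
        gcongr
        · exact h₂.trans (Real.exp_le_exp.2 (by linarith))
        · have := Real.add_one_le_exp (1 : ℝ)
          linarith
    _ ≤ Real.exp (-L) * Real.exp x := by
        rw [← Real.exp_add, ← Real.exp_add, Real.exp_le_exp]
        linarith [(abs_le.1 hx).1]

/-- Let `L = log (1/ε) > 1`, `M = B²`, `ρ = log (L/M)`. If `M < L`, then `N ≥ 60 L/ρ` gives `log
(N/M) ≥ log 60 + ρ - log ρ ≥ ρ/2 + 1`, since `log 60 ≥ 2` and `log ρ ≤ ρ/2`; hence `N (log (N/M) -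
1) ≥ 30 L`, which exceeds `L + M + 1`. If `M ≥ L`, then `N ≥ 60 M` makes the logarithm at least `2`,
and `N` alone suffices. -/
theorem degree_condition {ε B : ℝ} (hB : 0 < B) (hε : 0 < ε) (hε' : ε < 0.1) {N : ℕ}
    (hN : 60 * max 1 (degreeScale ε B) ≤ N) :
    2 * B ^ 2 ≤ N ∧
      Real.log (1 / ε) + B ^ 2 + 1 ≤ N * (Real.log (N / B ^ 2) - 1) := by
  have hL : 1 < Real.log (1 / ε) := by
    rw [Real.lt_log_iff_exp_lt (by positivity), lt_div_iff₀ hε]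
    have := Real.exp_one_lt_d9
    nlinarith
  set L := Real.log (1 / ε)
  set M := B ^ 2
  have hM : 0 < M := by positivity
  have h60 : 2 ≤ Real.log 60 := by
    rw [Real.le_log_iff_exp_le (by norm_num)]
    have h := Real.exp_one_lt_d9
    have : Real.exp 2 = Real.exp 1 * Real.exp 1 := by rw [← Real.exp_add]; norm_num
    rw [this]
    nlinarith [Real.exp_pos 1]
  have hs : degreeScale ε B ≤ max 1 (degreeScale ε B) := le_max_right _ _
  unfold degreeScale at hs hN
  split_ifs at hs hN with h
  · have hsM : M ≤ max (L / Real.log (L / M)) M := le_max_right _ _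
    have hsL : L / Real.log (L / M) ≤ max (L / Real.log (L / M)) M := le_max_left _ _
    have hNM : 60 * M ≤ N := by linarith
    refine ⟨by linarith, ?_⟩
    have hρ : 0 < Real.log (L / M) := Real.log_pos (by rwa [lt_div_iff₀ hM, one_mul])
    have hNL : 60 * (L / Real.log (L / M)) ≤ N := by linarith
    have hlog : Real.log (L / M) / 2 + 1 ≤ Real.log (N / M) := by
      have h₁ : Real.log (60 * (L / M) / Real.log (L / M)) ≤ Real.log (N / M) := by
        refine Real.log_le_log (by positivity) ?_
        calc 60 * (L / M) / Real.log (L / M) = 60 * (L / Real.log (L / M)) / M := by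
              field_simp
          _ ≤ N / M := by gcongr
      rw [Real.log_div (by positivity) hρ.ne', Real.log_mul (by norm_num) (by positivity)] at h₁
      have h₂ : Real.log (Real.log (L / M)) ≤ Real.log (L / M) / 2 := by
        have h₃ := Real.log_le_sub_one_of_pos (half_pos hρ)
        rw [Real.log_div hρ.ne' (by norm_num)] at h₃
        have := Real.log_two_lt_d9
        linarith
      linarith
    calc L + M + 1 ≤ 30 * L := by linarith
      _ = 60 * (L / Real.log (L / M)) * (Real.log (L / M) / 2) := by field_simp; norm_num
      _ ≤ N * (Real.log (N / M) - 1) := by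
          gcongr
          linarith
  · have hNM : 60 * M ≤ N := by linarith
    refine ⟨by linarith, ?_⟩
    have hlog : Real.log 60 ≤ Real.log (N / M) :=
      Real.log_le_log (by norm_num) (by rwa [le_div_iff₀ hM])
    have hlog' : 1 ≤ Real.log (N / M) - 1 := by linarith
    have : (N : ℝ) * 1 ≤ N * (Real.log (N / M) - 1) := by gcongr
    linarith [not_lt.1 h]

/-! ### Entries of masked attention and the error bound -/

theorem isUnit_rowSumDiag {n : ℕ} {A : Matrix (Fin n) (Fin n) ℝ}
    (h : ∀ i, ∑ j, A i j ≠ 0) : IsUnit (rowSumDiag A) := by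
  rw [rowSumDiag, Matrix.isUnit_diagonal, Pi.isUnit_iff]
  intro i
  simpa [Matrix.mulVec, dotProduct] using h i

theorem maskedAttention_apply {n d : ℕ} {W G : Matrix (Fin n) (Fin n) ℝ}
    (V : Matrix (Fin n) (Fin d) ℝ) (h : ∀ i, ∑ j, W i j * G i j ≠ 0) (i : Fin n) (c : Fin d) :
    maskedAttention W G V i c = (∑ j, W i j * G i j * V j c) / ∑ j, W i j * G i j := by
  have hv : ∀ i, ((W ⊙ G) *ᵥ 1) i = ∑ j, W i j * G i j := fun i => by
    simp [Matrix.mulVec, dotProduct]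
  have hinv : (rowSumDiag (W ⊙ G))⁻¹ = Matrix.diagonal fun i => (∑ j, W i j * G i j)⁻¹ := by
    refine Matrix.inv_eq_right_inv ?_
    rw [rowSumDiag, Matrix.diagonal_mul_diagonal, ← Matrix.diagonal_one]
    congr 1
    funext i
    rw [hv, mul_inv_cancel₀ (h i)]
  rw [maskedAttention, hinv, Matrix.mul_assoc, Matrix.diagonal_mul, Matrix.mul_apply,
    div_eq_inv_mul]
  simp

theorem masked_row_sum_pos {n : ℕ} {W G : Matrix (Fin n) (Fin n) ℝ} (hW : IsMask W)
    (hrow : ∀ i, ∃ j, W i j = 1) (hG : ∀ i j, 0 < G i j) (i : Fin n) :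
    0 < ∑ j, W i j * G i j := by
  obtain ⟨j, hj⟩ := hrow i
  refine Finset.sum_pos' (fun j _ => ?_) ⟨j, Finset.mem_univ j, by rw [hj, one_mul]; exact hG i j⟩
  rcases hW i j with h | h <;> simp [h, (hG i j).le]

theorem expScores_pos {n d : ℕ} (Q K : Matrix (Fin n) (Fin d) ℝ) (i j : Fin n) :
    0 < expScores Q K i j := Real.exp_pos _

/-- The entries are at least `(1 - ε) H i j`. Strict positivity is what makes the approximate row
sums invertible. -/
theorem IsLowRankApprox.pos {n k : ℕ} {ε : ℝ} {H : Matrix (Fin n) (Fin n) ℝ}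
    {U₁ U₂ : Matrix (Fin n) (Fin k) ℝ} (h : IsLowRankApprox ε H U₁ U₂) (hε : ε < 1)
    (hH : ∀ i j, 0 < H i j) (i j : Fin n) : 0 < (U₁ * U₂ᵀ) i j := by
  have h₁ := (abs_le.1 (h.close i j)).1
  nlinarith [hH i j]

/-- With numerators `P, P'` and row sums `S, S'`, both `|P - P'|` and `|P'| |S' - S| / S'` are at
most `ε S ‖V‖`, the latter because `|P'| ≤ S' ‖V‖`. The argument yields `2ε`, which is within the
claimed `4ε`. -/
theorem norm_maskedAttention_sub_le {n d : ℕ} {ε : ℝ} {W H G : Matrix (Fin n) (Fin n) ℝ}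
    (V : Matrix (Fin n) (Fin d) ℝ) (hW : IsMask W) (hrow : ∀ i, ∃ j, W i j = 1)
    (hε : 0 ≤ ε) (hH : ∀ i j, 0 < H i j) (hG : ∀ i j, 0 < G i j)
    (hclose : ∀ i j, |G i j - H i j| ≤ ε * H i j) :
    ‖maskedAttention W H V - maskedAttention W G V‖ ≤ 4 * ε * ‖V‖ := by
  rw [Matrix.norm_le_iff (by positivity)]
  intro i c
  have hD := masked_row_sum_pos hW hrow hH
  have hD' := masked_row_sum_pos hW hrow hG
  rw [Matrix.sub_apply, maskedAttention_apply V (fun i => (hD i).ne'),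
    maskedAttention_apply V (fun i => (hD' i).ne'), Real.norm_eq_abs]
  have hW0 : ∀ j, 0 ≤ W i j := fun j => by rcases hW i j with h | h <;> simp [h]
  have hV : ∀ j, |V j c| ≤ ‖V‖ := fun j => Matrix.norm_entry_le_entrywise_sup_norm V
  have hdiff : ∑ j, |W i j * H i j - W i j * G i j| ≤ ε * ∑ j, W i j * H i j := by
    rw [Finset.mul_sum]
    refine Finset.sum_le_sum fun j _ => ?_
    rw [← mul_sub, abs_mul, abs_of_nonneg (hW0 j), abs_sub_comm]
    calc W i j * |G i j - H i j| ≤ W i j * (ε * H i j) :=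
          mul_le_mul_of_nonneg_left (hclose i j) (hW0 j)
      _ = ε * (W i j * H i j) := by ring
  set S := ∑ j, W i j * H i j with hS
  set S' := ∑ j, W i j * G i j with hS'
  set P := ∑ j, W i j * H i j * V j c with hP
  set P' := ∑ j, W i j * G i j * V j c with hP'
  have hSpos : 0 < S := hD i
  have hSpos' : 0 < S' := hD' i
  have h₁ : |P - P'| ≤ ε * S * ‖V‖ := by
    rw [hP, hP', ← Finset.sum_sub_distrib]
    calc _ ≤ ∑ j, |W i j * H i j * V j c - W i j * G i j * V j c| :=
          Finset.abs_sum_le_sum_abs _ _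
      _ ≤ ∑ j, |W i j * H i j - W i j * G i j| * ‖V‖ := by
          refine Finset.sum_le_sum fun j _ => ?_
          rw [← sub_mul, abs_mul]
          exact mul_le_mul_of_nonneg_left (hV j) (abs_nonneg _)
      _ ≤ ε * S * ‖V‖ := by
          rw [← Finset.sum_mul]
          exact mul_le_mul_of_nonneg_right hdiff (norm_nonneg _)
  have h₂ : |S' - S| ≤ ε * S := by
    rw [abs_sub_comm, hS, hS', ← Finset.sum_sub_distrib]
    exact (Finset.abs_sum_le_sum_abs _ _).trans hdiff
  have h₃ : |P'| ≤ S' * ‖V‖ := by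
    rw [hP', hS', Finset.sum_mul]
    refine (Finset.abs_sum_le_sum_abs _ _).trans (Finset.sum_le_sum fun j _ => ?_)
    have : 0 ≤ W i j * G i j := mul_nonneg (hW0 j) (hG i j).le
    rw [abs_mul, abs_of_nonneg this]
    exact mul_le_mul_of_nonneg_left (hV j) this
  have h₄ : P / S - P' / S' = ((P - P') + P' * ((S' - S) / S')) / S := by
    field_simp
    ring
  rw [h₄, abs_div, abs_of_pos hSpos, div_le_iff₀ hSpos]
  have h₅ : |P' * ((S' - S) / S')| ≤ ε * S * ‖V‖ := by
    rw [abs_mul, abs_div, abs_of_pos hSpos', mul_div_assoc', div_le_iff₀ hSpos']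
    calc |P'| * |S' - S| ≤ S' * ‖V‖ * (ε * S) := by gcongr
      _ = _ := by ring
  have h₆ : 0 ≤ ε * S * ‖V‖ := by positivity
  calc _ ≤ |P - P'| + |P' * ((S' - S) / S')| := abs_add_le _ _
    _ ≤ 4 * ε * ‖V‖ * S := by linarith

/-! ### Monomial expansion of the truncated exponential of a sum -/

/-- The Taylor polynomial of degree `e` of the exponential. -/
noncomputable def expTaylor (e : ℕ) (y : ℝ) : ℝ :=
  ∑ m ∈ Finset.range (e + 1), y ^ m / m.factorial

/-- The product of two exponential series, truncated by total degree. The induction adds the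
homogeneous part of degree `e + 1`, given by the binomial theorem. -/
theorem expTaylor_add (e : ℕ) (a b : ℝ) : expTaylor e (a + b) =
    ∑ j ∈ Finset.range (e + 1), a ^ j / j.factorial * expTaylor (e - j) b := by
  induction e with
  | zero => simp [expTaylor]
  | succ e ih =>
    have h₁ : expTaylor (e + 1) (a + b) =
        expTaylor e (a + b) + (a + b) ^ (e + 1) / (e + 1).factorial := by
      rw [expTaylor, Finset.sum_range_succ, ← expTaylor]
    have h₂ : (a + b) ^ (e + 1) / (e + 1).factorial = ∑ j ∈ Finset.range (e + 2),
        a ^ j / j.factorial * (b ^ (e + 1 - j) / (e + 1 - j).factorial) := by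
      rw [add_pow, Finset.sum_div]
      refine Finset.sum_congr rfl fun j hj => ?_
      rw [Nat.cast_choose ℝ (Nat.lt_succ_iff.1 (Finset.mem_range.1 hj))]
      field_simp
    rw [h₁, ih, h₂, Finset.sum_range_succ _ (e + 1), Finset.sum_range_succ _ (e + 1), ← add_assoc,
      ← Finset.sum_add_distrib]
    congr 1
    · refine Finset.sum_congr rfl fun j hj => ?_
      have : e + 1 - j = e - j + 1 := by
        have := Finset.mem_range.1 hj
        omega
      rw [this, ← mul_add, expTaylor, expTaylor, Finset.sum_range_succ _ (e - j + 1)]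
    · simp [expTaylor]

/-- The sum, divided by the monomial at the root, of the terms below a node in the tree of
monomials of the expansion of the truncated exponential of `x 0 + ⋯ + x (d - 1)`; the node has
last variable `x v`, which occurs `μ` times, and up to `e` factors can still be appended. -/
noncomputable def subtreeSum (d : ℕ) (x : ℕ → ℝ) : ℕ → ℕ → ℕ → ℝ
  | 0, _, _ => 1
  | e + 1, v, μ => 1 + ∑ s ∈ Finset.range (d - v), x (v + s) / ((if s = 0 then μ else 0) + 1 : ℕ) *
      subtreeSum d x e (v + s) ((if s = 0 then μ else 0) + 1)

/-- The closed form of `subtreeSum`. -/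
noncomputable def subtreeForm (d : ℕ) (x : ℕ → ℝ) (e v μ : ℕ) : ℝ :=
  ∑ j ∈ Finset.range (e + 1), x v ^ j * μ.factorial / (μ + j).factorial *
    expTaylor (e - j) (∑ w ∈ Finset.Ico (v + 1) d, x w)

/-- With multiplicity `0` the factor `μ! / (μ + j)!` is `1 / j!`, and `expTaylor_add` merges `x v`
with the later variables. This applies at the root. -/
theorem subtreeForm_zero_mult {d v : ℕ} (hv : v < d) (x : ℕ → ℝ) (e : ℕ) :
    subtreeForm d x e v 0 = expTaylor e (∑ w ∈ Finset.Ico v d, x w) := by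
  rw [Finset.sum_eq_sum_Ico_succ_bot hv, expTaylor_add, subtreeForm]
  simp

/-- Either `x v` is not used again (`j = 0`), or one more factor `x v` is split off; dividing by `μ
+ 1` each time builds up the factorial. -/
theorem subtreeForm_succ (d v : ℕ) (x : ℕ → ℝ) (e μ : ℕ) :
    subtreeForm d x (e + 1) v μ = expTaylor (e + 1) (∑ w ∈ Finset.Ico (v + 1) d, x w) +
      x v / (μ + 1 : ℕ) * subtreeForm d x e v (μ + 1) := by
  rw [subtreeForm, Finset.sum_range_succ', add_comm, subtreeForm, Finset.mul_sum]
  congr 1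
  · simp [Nat.factorial_ne_zero]
  · refine Finset.sum_congr rfl fun j _ => ?_
    have h : μ + 1 + j = μ + (j + 1) := by ring
    rw [h, Nat.factorial_succ μ, Nat.add_sub_add_right]
    push_cast
    field_simp
    ring

/-- Nonconstant monomials are sorted by their first variable `x (v + s)`. -/
theorem expTaylor_succ_eq_sum (d : ℕ) (x : ℕ → ℝ) (e : ℕ) (r v : ℕ) (h : v + r = d) :
    expTaylor (e + 1) (∑ w ∈ Finset.Ico v d, x w) =
      1 + ∑ s ∈ Finset.range r, x (v + s) * subtreeForm d x e (v + s) 1 := by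
  induction r generalizing v with
  | zero =>
    obtain rfl : v = d := by omega
    simp [expTaylor, Finset.sum_range_succ']
  | succ r ih =>
    rw [← subtreeForm_zero_mult (by omega), subtreeForm_succ, ih (v + 1) (by omega),
      Finset.sum_range_succ']
    simp only [add_assoc, add_comm 1]
    simp

/-- Both sides obey the same recursion: the child `s = 0` repeats the last variable
(`subtreeForm_succ`), the others begin a new one (`expTaylor_succ_eq_sum`). -/
theorem subtreeSum_eq {d v : ℕ} (hv : v < d) (x : ℕ → ℝ) (e μ : ℕ) :
    subtreeSum d x e v μ = subtreeForm d x e v μ := by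
  induction e generalizing v μ with
  | zero => simp [subtreeSum, subtreeForm, expTaylor, Nat.factorial_ne_zero]
  | succ e ih =>
    obtain ⟨r, hr⟩ : ∃ r, d - v = r + 1 := ⟨d - v - 1, by omega⟩
    rw [subtreeForm_succ, expTaylor_succ_eq_sum d x e r (v + 1) (by omega), subtreeSum, hr,
      Finset.sum_range_succ', ← add_assoc]
    congr 2
    · refine Finset.sum_congr rfl fun s hs => ?_
      have := Finset.mem_range.1 hs
      rw [ih (by omega)]
      simp [add_assoc, add_comm 1]
    · simp [ih hv]

/-! ### The tree of monomials -/

/-- A monomial: its values (with coefficient) at the rows of the two matrices, the number of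
factors which can still be appended, the last variable and its multiplicity. -/
structure Node where
  u₁ : ℕ → ℝ
  u₂ : ℕ → ℝ
  deg : ℕ
  var : ℕ
  mult : ℕ

/-- The constant monomial `1`. -/
def Node.root (g : ℕ) : Node := ⟨fun _ => 1, fun _ => 1, g, 0, 0⟩

/-- Append the variable `w` as `μ + 1`-st factor of this kind. -/
noncomputable def Node.child (d : ℕ) (q κ : ℕ → ℕ → ℝ) (x : Node) (w μ : ℕ) : Node :=
  ⟨fun i => x.u₁ i * q i w / ((μ + 1 : ℕ) * d), fun i => x.u₂ i * κ i w, x.deg - 1, w, μ + 1⟩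

/-- The first `r` possibilities to append a variable not preceding the last one. -/
noncomputable def Node.childrenUpTo (d : ℕ) (q κ : ℕ → ℕ → ℝ) (x : Node) (r : ℕ) : List Node :=
  (List.range r).map fun s => x.child d q κ (x.var + s) (if s = 0 then x.mult else 0)

/-- All monomials obtained by appending a variable not preceding the last one. -/
noncomputable def Node.children (d : ℕ) (q κ : ℕ → ℕ → ℝ) (x : Node) : List Node :=
  if x.deg = 0 then [] else x.childrenUpTo d q κ (d - x.var)

/-- Move the first unprocessed node to the processed ones, and append its children to the
unprocessed ones. -/
noncomputable def expand (d : ℕ) (q κ : ℕ → ℕ → ℝ) : List Node × List Node → List Node × List Node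
  | (done, []) => (done, [])
  | (done, x :: todo) => (done ++ [x], todo ++ x.children d q κ)

/-- The processed and the unprocessed nodes after `h` steps. -/
noncomputable def worklist (d g : ℕ) (q κ : ℕ → ℕ → ℝ) (h : ℕ) : List Node × List Node :=
  (expand d q κ)^[h] ([], [Node.root g])

theorem worklist_succ (d g : ℕ) (q κ : ℕ → ℕ → ℝ) (h : ℕ) :
    worklist d g q κ (h + 1) = expand d q κ (worklist d g q κ h) :=
  Function.iterate_succ_apply' _ _ _

/-! ### Counting the nodes of the tree. -/

theorem list_sum_map_range {M : Type*} [AddCommMonoid M] (f : ℕ → M) (r : ℕ) :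
    ((List.range r).map f).sum = ∑ s ∈ Finset.range r, f s := by
  induction r with
  | zero => simp
  | succ r ih => simp [List.range_succ, Finset.sum_range_succ, ih]

/-- The number of nodes of the tree below a node. -/
def Node.size (d : ℕ) (x : Node) : ℕ := (x.deg + (d - x.var)).choose x.deg

theorem Node.size_pos (d : ℕ) (x : Node) : 0 < x.size d := Nat.choose_pos (Nat.le_add_right _ _)

/-- The hockey stick identity. -/
theorem sum_choose_add (e r : ℕ) :
    ∑ s ∈ Finset.range r, (e + (r - s)).choose e + 1 = (e + 1 + r).choose (e + 1) := by
  have h : ∑ s ∈ Finset.range r, (e + (r - s)).choose e =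
      ∑ s ∈ Finset.range r, (e + (s + 1)).choose e := by
    rw [← Finset.sum_range_reflect]
    refine Finset.sum_congr rfl fun s hs => ?_
    have := Finset.mem_range.1 hs
    congr 2
    omega
  rw [h]
  clear h
  induction r with
  | zero => simp
  | succ r ih =>
    rw [Finset.sum_range_succ, add_right_comm, ih, ← add_assoc (e + 1) r 1,
      Nat.choose_succ_succ (e + 1 + r) e, add_comm]
    congr 2
    ring

/-- `Node.size` counts the monomials of degree at most `deg` in the `d - var` variables still
allowed, and this number satisfies the recursion of the tree by `sum_choose_add`. -/
theorem Node.size_children (d : ℕ) (q κ : ℕ → ℕ → ℝ) (x : Node) :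
    ((x.children d q κ).map (Node.size d)).sum + 1 = x.size d := by
  rw [Node.children]
  split_ifs with h
  · simp [Node.size, h]
  · obtain ⟨e, he⟩ := Nat.exists_eq_succ_of_ne_zero h
    rw [Node.childrenUpTo, List.map_map, list_sum_map_range, Node.size, he, Nat.succ_eq_add_one,
      ← sum_choose_add]
    congr 1
    refine Finset.sum_congr rfl fun s _ => ?_
    simp only [Function.comp, Node.size, Node.child, he, Nat.sub_sub, Nat.succ_eq_add_one,
      Nat.add_sub_cancel]

theorem size_expand (d : ℕ) (q κ : ℕ → ℕ → ℝ) (p : List Node × List Node) :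
    (expand d q κ p).1.length + ((expand d q κ p).2.map (Node.size d)).sum =
      p.1.length + (p.2.map (Node.size d)).sum := by
  obtain ⟨D, _ | ⟨x, T⟩⟩ := p
  · rfl
  · have := x.size_children d q κ
    simp only [expand, List.length_append, List.length_singleton, List.map_append,
      List.sum_append, List.map_cons, List.sum_cons]
    omega

theorem size_worklist (d g : ℕ) (q κ : ℕ → ℕ → ℝ) (h : ℕ) :
    (worklist d g q κ h).1.length + ((worklist d g q κ h).2.map (Node.size d)).sum =
      (g + d).choose g := by
  induction h with
  | zero => simp [worklist, Node.size, Node.root]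
  | succ h ih => rw [worklist_succ, size_expand, ih]

/-- By the conserved count `size_worklist`, the list of pending nodes cannot be empty before all `(g
+ d).choose g` nodes are processed, so every earlier step processes one. -/
theorem length_done {d g : ℕ} {q κ : ℕ → ℕ → ℝ} {h : ℕ} (hh : h ≤ (g + d).choose g) :
    (worklist d g q κ h).1.length = h := by
  induction h with
  | zero => rfl
  | succ h ih =>
    have ih := ih (by omega)
    have hs := size_worklist d g q κ h
    rw [worklist_succ]
    rcases hw : worklist d g q κ h with ⟨D, _ | ⟨x, T⟩⟩
    · rw [hw] at hs ih
      simp only [List.map_nil, List.sum_nil] at hs ih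
      omega
    · rw [hw] at ih
      simp only at ih
      simp only [expand, List.length_append, List.length_singleton]
      omega

theorem todo_ne_nil {d g : ℕ} {q κ : ℕ → ℕ → ℝ} {h : ℕ} (hh : h < (g + d).choose g) :
    (worklist d g q κ h).2 ≠ [] := by
  intro hn
  have hs := size_worklist d g q κ h
  rw [length_done hh.le, hn] at hs
  simp only [List.map_nil, List.sum_nil] at hs
  omega

theorem todo_eq_nil (d g : ℕ) (q κ : ℕ → ℕ → ℝ) :
    (worklist d g q κ ((g + d).choose g)).2 = [] := by
  have hs := size_worklist d g q κ ((g + d).choose g)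
  rw [length_done le_rfl] at hs
  rcases hw : worklist d g q κ ((g + d).choose g) with ⟨D, _ | ⟨x, T⟩⟩
  · rfl
  · rw [hw] at hs
    have := x.size_pos d
    simp only [List.map_cons, List.sum_cons] at hs
    omega

/-! ### Summing the values of the nodes. -/

/-- The value of a monomial. -/
def Node.val (i j : ℕ) (x : Node) : ℝ := x.u₁ i * x.u₂ j

/-- The sum of all monomials below a node. -/
noncomputable def Node.total (d : ℕ) (q κ : ℕ → ℕ → ℝ) (i j : ℕ) (x : Node) : ℝ :=
  x.val i j * subtreeSum d (fun w => q i w * κ j w / d) x.deg x.var x.mult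

theorem Node.total_children (d : ℕ) (q κ : ℕ → ℕ → ℝ) (i j : ℕ) (x : Node) :
    x.val i j + ((x.children d q κ).map (Node.total d q κ i j)).sum = x.total d q κ i j := by
  rw [Node.children, Node.total]
  split_ifs with h
  · simp [h, subtreeSum]
  · obtain ⟨e, he⟩ := Nat.exists_eq_succ_of_ne_zero h
    rw [Node.childrenUpTo, List.map_map, list_sum_map_range, he, Nat.succ_eq_add_one, subtreeSum,
      mul_add, mul_one, Finset.mul_sum]
    congr 1
    refine Finset.sum_congr rfl fun s _ => ?_
    simp only [Function.comp, Node.total, Node.child, Node.val, he, Nat.succ_eq_add_one,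
      Nat.add_sub_cancel]
    field_simp

theorem total_worklist (d g : ℕ) (q κ : ℕ → ℕ → ℝ) (i j h : ℕ) :
    ((worklist d g q κ h).1.map (Node.val i j)).sum +
      ((worklist d g q κ h).2.map (Node.total d q κ i j)).sum =
        subtreeSum d (fun w => q i w * κ j w / d) g 0 0 := by
  induction h with
  | zero => simp [worklist, Node.total, Node.root, Node.val]
  | succ h ih =>
    rw [worklist_succ, ← ih]
    obtain ⟨D, _ | ⟨x, T⟩⟩ := worklist d g q κ h
    · rfl
    · simp only [expand, List.map_append, List.sum_append, List.map_cons, List.sum_cons,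
        List.map_nil, List.sum_nil, ← x.total_children d q κ i j]
      ring

/-- At the end nothing is pending, so the conserved total of `total_worklist` is the sum over the
processed nodes; at the root it is the Taylor polynomial. -/
theorem sum_val_worklist {d : ℕ} (hd : 0 < d) (g : ℕ) (q κ : ℕ → ℕ → ℝ) (i j : ℕ) :
    ((worklist d g q κ ((g + d).choose g)).1.map (Node.val i j)).sum =
      expTaylor g ((∑ w ∈ Finset.range d, q i w * κ j w) / d) := by
  have h := total_worklist d g q κ i j ((g + d).choose g)
  rw [todo_eq_nil, List.map_nil, List.sum_nil, add_zero, subtreeSum_eq hd,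
    subtreeForm_zero_mult hd, Nat.Ico_zero_eq_range, ← Finset.sum_div] at h
  exact h

/-! ### The program computing the factors

Column `l` of the real arrays `3` and `4` contains the values of the `l`-th node, and the entries
`l` of row `0` of the number arrays `2`, `3`, `4` its other components. Register `2` contains the
number of nodes found, register `8` the number of processed nodes. -/

/-- Append to the list of nodes the child of the node given by register `8` obtained by appending
the variable given by register `11`, with the multiplicity given by register `12`. -/
def addChild : Prog :=
  .seq (.block [.natAdd 12 12 7, .natStore 2 5 2 13, .natStore 3 5 2 11, .natStore 4 5 2 12,
      .realOfNat 3 12, .realMul 3 3 2])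
    (.seq
      (.for 9 0 (.block [.realLoad 4 3 9 8, .realLoad 5 0 9 11, .realMul 4 4 5, .realDiv 4 4 3,
        .realStore 3 9 2 4, .realLoad 4 4 9 8, .realLoad 5 1 9 11, .realMul 4 4 5,
        .realStore 4 9 2 4]))
      (.block [.natAdd 2 2 7, .natConst 12 0, .natAdd 11 11 7]))

/-- Append to the list of nodes the children of the node given by register `8`. -/
def addChildren : Prog :=
  .seq (.block [.natLoad 10 2 5 8, .natLoad 11 3 5 8, .natLoad 12 4 5 8])
    (.seq
      (.ite (.natEq 10 5) .skip
        (.seq (.block [.natSub 13 10 7]) (.loop (.natLt 11 1) addChild)))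
      (.block [.natAdd 8 8 7]))

/-- Compute the factors. -/
def computeFactors : Prog :=
  .seq (.block [.natConst 5 0, .natConst 7 1, .realOfNat 1 7, .realOfNat 2 1, .natConst 2 1,
      .natConst 8 0, .natStore 2 5 5 4, .natStore 3 5 5 5, .natStore 4 5 5 5])
    (.seq (.for 9 0 (.block [.realStore 3 9 5 1, .realStore 4 9 5 1]))
      (.loop (.natLt 8 2) addChildren))

/-- The memory contains the node `x` as node number `l`. -/
structure StoresNode (n : ℕ) (τ : State) (l : ℕ) (x : Node) : Prop where
  deg : τ.natArr 2 0 l = x.deg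
  var : τ.natArr 3 0 l = x.var
  mult : τ.natArr 4 0 l = x.mult
  u₁ : ∀ i < n, τ.realArr 3 i l = x.u₁ i
  u₂ : ∀ i < n, τ.realArr 4 i l = x.u₂ i

/-- The memory contains the nodes of the list `L`. -/
def StoresNodes (n : ℕ) (τ : State) (L : List Node) : Prop :=
  τ.natReg 2 = L.length ∧ ∀ l x, L[l]? = some x → StoresNode n τ l x

/-- The constants the program relies on are in place. -/
structure FactorReady (n d : ℕ) (q κ : ℕ → ℕ → ℝ) (τ : State) : Prop where
  rows : τ.natReg 0 = n
  cols : τ.natReg 1 = d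
  natZero : τ.natReg 5 = 0
  natOne : τ.natReg 7 = 1
  realCols : τ.realReg 2 = d
  left : ∀ i < n, ∀ w < d, τ.realArr 0 i w = q i w
  right : ∀ i < n, ∀ w < d, τ.realArr 1 i w = κ i w

theorem FactorReady.of_frame {n d : ℕ} {q κ : ℕ → ℕ → ℝ} {p : Prog} {σ τ : State}
    (h : FactorReady n d q κ σ) (hF : Frame p σ τ) (hN : ∀ x ∈ [0, 1, 5, 7], p.Keeps (.natReg x))
    (hR : p.Keeps (.realReg 2)) (hA : ∀ a ∈ [0, 1], p.Keeps (.realArr a)) :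
    FactorReady n d q κ τ :=
  ⟨(hF.natReg 0 (hN _ (by simp))).trans h.rows, (hF.natReg 1 (hN _ (by simp))).trans h.cols,
    (hF.natReg 5 (hN _ (by simp))).trans h.natZero, (hF.natReg 7 (hN _ (by simp))).trans h.natOne,
    (hF.realReg 2 hR).trans h.realCols,
    by rw [hF.realArr 0 (hA _ (by simp))]; exact h.left,
    by rw [hF.realArr 1 (hA _ (by simp))]; exact h.right⟩

theorem getElem?_concat_eq_some {α : Type*} {L : List α} {x y : α} {l : ℕ}
    (h : (L ++ [y])[l]? = some x) : L[l]? = some x ∧ l ≠ L.length ∨ l = L.length ∧ x = y := by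
  rcases lt_trichotomy l L.length with hl | rfl | hl
  · rw [List.getElem?_append_left hl] at h
    exact .inl ⟨h, hl.ne⟩
  · rw [List.getElem?_concat_length] at h
    exact .inr ⟨rfl, (Option.some_injective _ h).symm⟩
  · rw [List.getElem?_eq_none (by simp; omega)] at h
    cases h

/-- A new column is the parent's column times one column of the input, so its cost does not depend
on the degree. The coefficient `1 / ((μ + 1) d)` goes entirely into the left factor. -/
theorem wp_addChild {n d : ℕ} {q κ : ℕ → ℕ → ℝ} {σ : State} (h : FactorReady n d q κ σ)
    {L : List Node} (hL : StoresNodes n σ L) {x : Node} {m w μ : ℕ} (hx : L[m]? = some x)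
    (hm : σ.natReg 8 = m) (hw : σ.natReg 11 = w) (hwd : w < d) (hμ : σ.natReg 12 = μ)
    (he : σ.natReg 13 = x.deg - 1) :
    WP addChild σ fun t τ => t ≤ 12 * n + 11 ∧ StoresNodes n τ (L ++ [x.child d q κ w μ]) ∧
      τ.natReg 11 = w + 1 ∧ τ.natReg 12 = 0 := by
  obtain ⟨hlen, hL⟩ := hL
  have hmL : m < L.length := (List.getElem?_eq_some_iff.1 hx).1
  have hmne : m ≠ L.length := hmL.ne
  rw [addChild, wp_seq]
  simp only [wp_block_cons, wp_block_nil, Instr.Defined, true_and, Instr.apply, wp_seq]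
  refine wp_for_const n 9 (fun i' τ =>
    (∀ l, l ≠ L.length → ∀ i, τ.realArr 3 i l = σ.realArr 3 i l ∧
      τ.realArr 4 i l = σ.realArr 4 i l) ∧
    ∀ i < i', τ.realArr 3 i L.length = (x.child d q κ w μ).u₁ i ∧
      τ.realArr 4 i L.length = (x.child d q κ w μ).u₂ i) (by simp [h.rows]) (by simp)
    (by simp) ?_ ?_
  · rintro i hi τ hF hi' ⟨hold, hnew⟩
    have h2 : τ.natReg 2 = L.length := by rw [hF.natReg 2 (by simp)]; simp [hlen]
    have h8 : τ.natReg 8 = m := by rw [hF.natReg 8 (by simp)]; simp [hm]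
    have h11 : τ.natReg 11 = w := by rw [hF.natReg 11 (by simp)]; simp [hw]
    have hr3 : τ.realReg 3 = (μ + 1 : ℕ) * d := by
      rw [hF.realReg 3 (by simp)]; simp [hμ, h.natOne, h.realCols]
    have hr3' : τ.realReg 3 ≠ 0 := by
      rw [hr3]
      have : (d : ℝ) ≠ 0 := by norm_cast; omega
      positivity
    have ha0 : τ.realArr 0 i w = q i w := by
      rw [hF.realArr 0 (by simp)]; exact h.left i hi w hwd
    have ha1 : τ.realArr 1 i w = κ i w := by
      rw [hF.realArr 1 (by simp)]; exact h.right i hi w hwd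
    have hu₁ : τ.realArr 3 i m = x.u₁ i := by rw [(hold m hmne i).1, (hL m x hx).u₁ i hi]
    have hu₂ : τ.realArr 4 i m = x.u₂ i := by rw [(hold m hmne i).2, (hL m x hx).u₂ i hi]
    simp only [wp_block_cons, wp_block_nil]
    simp [h2, h8, h11, hi', ha0, ha1, hu₁, hu₂, hr3']
    refine ⟨fun l hl j => ?_, fun j hj => ?_⟩
    · simpa [hl] using hold l hl j
    · by_cases hji : j = i
      · subst hji
        simp [Node.child, hr3]
      · simpa [hji] using hnew j (by omega)
  · rintro t τ ht hF ⟨hold, hnew⟩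
    have h2 : τ.natReg 2 = L.length := by rw [hF.natReg 2 (by simp)]; simp [hlen]
    have h7 : τ.natReg 7 = 1 := by rw [hF.natReg 7 (by simp)]; simp [h.natOne]
    have h11 : τ.natReg 11 = w := by rw [hF.natReg 11 (by simp)]; simp [hw]
    have hA : ∀ l, l ≠ L.length → τ.natArr 2 0 l = σ.natArr 2 0 l ∧
        τ.natArr 3 0 l = σ.natArr 3 0 l ∧ τ.natArr 4 0 l = σ.natArr 4 0 l := by
      intro l hl
      rw [hF.natArr 2 (by simp), hF.natArr 3 (by simp), hF.natArr 4 (by simp)]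
      simp [hlen, hl]
    have hB : τ.natArr 2 0 L.length = x.deg - 1 ∧ τ.natArr 3 0 L.length = w ∧
        τ.natArr 4 0 L.length = μ + 1 := by
      rw [hF.natArr 2 (by simp), hF.natArr 3 (by simp), hF.natArr 4 (by simp)]
      simp [hlen, h.natZero, he, hw, hμ, h.natOne]
    simp only [StoresNodes]
    simp [h2, h7, h11]
    refine ⟨by omega, fun l y hy => ?_⟩
    rcases getElem?_concat_eq_some hy with ⟨hy, hl⟩ | ⟨rfl, rfl⟩
    · have hs := hL l y hy
      obtain ⟨ha, hb, hc⟩ := hA l hl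
      exact ⟨ha.trans hs.deg, hb.trans hs.var, hc.trans hs.mult,
        fun i hi => ((hold l hl i).1).trans (hs.u₁ i hi),
        fun i hi => ((hold l hl i).2).trans (hs.u₂ i hi)⟩
    · exact ⟨hB.1, hB.2.1, hB.2.2, fun i hi => (hnew i hi).1, fun i hi => (hnew i hi).2⟩

theorem Node.childrenUpTo_succ (d : ℕ) (q κ : ℕ → ℕ → ℝ) (x : Node) (r : ℕ) :
    x.childrenUpTo d q κ (r + 1) = x.childrenUpTo d q κ r ++
      [x.child d q κ (x.var + r) (if r = 0 then x.mult else 0)] := by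
  simp [Node.childrenUpTo, List.range_succ]

theorem wp_addChildren {n d : ℕ} {q κ : ℕ → ℕ → ℝ} {σ : State} (h : FactorReady n d q κ σ)
    {L : List Node} (hL : StoresNodes n σ L) {x : Node} {m : ℕ} (hx : L[m]? = some x)
    (hm : σ.natReg 8 = m) :
    WP addChildren σ fun t τ => t ≤ 7 + (12 * n + 12) * (x.children d q κ).length ∧
      StoresNodes n τ (L ++ x.children d q κ) ∧ τ.natReg 8 = m + 1 := by
  have hs := hL.2 m x hx
  rw [addChildren, wp_seq]
  simp only [wp_block_cons, wp_block_nil, Instr.Defined, true_and, Instr.apply]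
  rw [wp_seq]
  refine wp_ite ?_ ?_
  · intro hc
    have he : x.deg = 0 := by
      simpa [Test.Holds, h.natZero, hm, hs.deg] using hc
    have hch : x.children d q κ = [] := by simp [Node.children, he]
    rw [wp_skip]
    simp [hch, hm, h.natOne]
    exact ⟨by simpa using hL.1, fun l y hy =>
      ⟨(hL.2 l y hy).deg, (hL.2 l y hy).var, (hL.2 l y hy).mult, (hL.2 l y hy).u₁,
        (hL.2 l y hy).u₂⟩⟩
  · intro hc
    have he : x.deg ≠ 0 := by
      simpa [Test.Holds, h.natZero, hm, hs.deg] using hc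
    have hch : x.children d q κ = x.childrenUpTo d q κ (d - x.var) := by
      rw [Node.children, if_neg he]
    rw [wp_seq]
    simp only [wp_block_cons, wp_block_nil, Instr.Defined, true_and, Instr.apply]
    -- `addChild` resets register `12` to `0`, so only the first child, which repeats the last
    -- variable, inherits the multiplicity.
    refine wp_loop (d - x.var) (fun _ => 12 * n + 11) (fun r τ =>
      StoresNodes n τ (L ++ x.childrenUpTo d q κ r) ∧ τ.natReg 11 = x.var + r ∧
        τ.natReg 12 = if r = 0 then x.mult else 0) ?_ ?_ ?_
    · refine ⟨⟨?_, fun l y hy => ?_⟩, ?_, ?_⟩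
      · simpa [Node.childrenUpTo] using hL.1
      · have hs' := hL.2 l y (by simpa [Node.childrenUpTo] using hy)
        exact ⟨hs'.deg, hs'.var, hs'.mult, hs'.u₁, hs'.u₂⟩
      · simp [h.natZero, hm, hs.var]
      · simp [h.natZero, hm, hs.mult]
    · rintro r hr τ hF ⟨hN, h11, h12⟩
      have hR : FactorReady n d q κ τ := by
        refine FactorReady.of_frame ?_ hF (by simp [addChild]) (by simp [addChild])
          (by simp [addChild])
        exact ⟨by simp [h.rows], by simp [h.cols], by simp [h.natZero], by simp [h.natOne],
          h.realCols, h.left, h.right⟩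
      have h8 : τ.natReg 8 = m := by rw [hF.natReg 8 (by simp [addChild])]; simp [hm]
      have h13 : τ.natReg 13 = x.deg - 1 := by
        rw [hF.natReg 13 (by simp [addChild])]
        simp [hm, h.natZero, hs.deg, h.natOne]
      refine ⟨?_, ?_⟩
      · simp only [Test.Holds, h11, hR.cols]
        omega
      · have hx' : (L ++ x.childrenUpTo d q κ r)[m]? = some x := by
          rw [List.getElem?_append_left (List.getElem?_eq_some_iff.1 hx).1, hx]
        refine (wp_addChild hR hN hx' h8 h11 (by omega) h12 h13).mono ?_
        rintro t τ' - ⟨ht, hN', h11', h12'⟩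
        refine ⟨ht, ?_, by omega, by simpa using h12'⟩
        rwa [Node.childrenUpTo_succ, ← List.append_assoc]
    · rintro t τ ht hF ⟨hN, h11, -⟩
      have h1 : τ.natReg 1 = d := by rw [hF.natReg 1 (by simp [addChild])]; simp [h.cols]
      have h7 : τ.natReg 7 = 1 := by rw [hF.natReg 7 (by simp [addChild])]; simp [h.natOne]
      have h8 : τ.natReg 8 = m := by rw [hF.natReg 8 (by simp [addChild])]; simp [hm]
      refine ⟨by simp only [Test.Holds, h11, h1]; omega, ?_⟩
      have hlen : (x.children d q κ).length = d - x.var := by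
        simp [hch, Node.childrenUpTo]
      rw [hlen, hch]
      simp [h8, h7]
      simp only [Finset.sum_const, Finset.card_range, smul_eq_mul] at ht
      refine ⟨?_, by simpa using hN.1, fun l y hy => ?_⟩
      · have : (d - x.var) * (12 * n + 11 + 1) = (12 * n + 12) * (d - x.var) := by ring
        omega
      · have hs' := hN.2 l y hy
        exact ⟨hs'.deg, hs'.var, hs'.mult, hs'.u₁, hs'.u₂⟩

theorem wp_computeFactors {n d g : ℕ} {q κ : ℕ → ℕ → ℝ} {σ : State} (hn : σ.natReg 0 = n)
    (hd : σ.natReg 1 = d) (hg : σ.natReg 4 = g)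
    (hq : ∀ i < n, ∀ w < d, σ.realArr 0 i w = q i w)
    (hκ : ∀ i < n, ∀ w < d, σ.realArr 1 i w = κ i w) :
    WP computeFactors σ fun t τ =>
      t ≤ 9 * (g + d).choose g + (12 * n + 12) * (g + d).choose g + 5 * n + 12 ∧
      StoresNodes n τ (worklist d g q κ ((g + d).choose g)).1 := by
  set N := (g + d).choose g with hN
  rw [computeFactors, wp_seq]
  simp only [wp_block_cons, wp_block_nil, Instr.Defined, true_and, Instr.apply]
  rw [wp_seq]
  refine wp_for_const n 2 (fun m τ => ∀ i < m, τ.realArr 3 i 0 = 1 ∧ τ.realArr 4 i 0 = 1)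
    (by simp [hn]) (by simp) (by simp) ?_ ?_
  · rintro m hm τ hF hi h
    have h5 : τ.natReg 5 = 0 := by rw [hF.natReg 5 (by simp)]; simp
    have h1 : τ.realReg 1 = 1 := by rw [hF.realReg 1 (by simp)]; simp
    simp only [wp_block_cons, wp_block_nil]
    simp [h5, h1, hi]
    exact fun i hi => ⟨fun hne => (h i (by omega)).1, fun hne => (h i (by omega)).2⟩
  rintro t₁ τ₁ ht₁ hF₁ hone
  have hR : FactorReady n d q κ τ₁ := by
    refine FactorReady.of_frame ?_ hF₁ (by simp) (by simp) (by simp)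
    exact ⟨by simp [hn], by simp [hd], by simp, by simp, by simp [hd], hq, hκ⟩
  have h8 : τ₁.natReg 8 = 0 := by rw [hF₁.natReg 8 (by simp)]; simp
  have hroot : StoresNodes n τ₁ [Node.root g] := by
    refine ⟨by rw [hF₁.natReg 2 (by simp)]; simp, fun l x hx => ?_⟩
    obtain ⟨hl, rfl⟩ := List.getElem?_eq_some_iff.1 hx
    obtain rfl : l = 0 := by simpa using hl
    refine ⟨?_, ?_, ?_, fun i hi => (hone i hi).1, fun i hi => (hone i hi).2⟩
    · rw [hF₁.natArr 2 (by simp)]; simp [hg, Node.root]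
    · rw [hF₁.natArr 3 (by simp)]; simp [Node.root]
    · rw [hF₁.natArr 4 (by simp)]; simp [Node.root]
  set W := worklist d g q κ with hW
  -- The number of nodes in memory after `h` steps. Step `h` costs `7` plus a multiple of the number
  -- `ℓ (h + 1) - ℓ h` of new children, so the total telescopes.
  set ℓ : ℕ → ℕ := fun h => (W h).1.length + (W h).2.length with hℓ
  have hmono : Monotone ℓ := by
    refine monotone_nat_of_le_succ fun h => ?_
    simp only [hℓ, hW, worklist_succ]
    rcases worklist d g q κ h with ⟨D, _ | ⟨x, T⟩⟩
    · exact le_rfl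
    · simp [expand]; omega
  -- The arrays hold processed nodes followed by pending ones, with register `8` at the boundary:
  -- processing a node moves the boundary, and children are appended at the end.
  refine wp_loop N (fun h => 7 + (12 * n + 12) * (ℓ (h + 1) - ℓ h))
    (fun h τ => τ.natReg 8 = h ∧ StoresNodes n τ ((W h).1 ++ (W h).2)) ⟨h8, hroot⟩ ?_ ?_
  · rintro h hh τ hF ⟨h8, hst⟩
    have hR' : FactorReady n d q κ τ := hR.of_frame hF (by simp [addChildren, addChild])
      (by simp [addChildren, addChild]) (by simp [addChildren, addChild])
    have hlen : (W h).1.length = h := length_done hh.le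
    have hne : (W h).2 ≠ [] := todo_ne_nil hh
    have hsucc : W (h + 1) = expand d q κ (W h) := worklist_succ d g q κ h
    simp only [hℓ, hsucc]
    rcases hw : W h with ⟨D, _ | ⟨x, T⟩⟩
    · simp [hw] at hne
    rw [hw] at hst hlen
    simp only at hst hlen
    refine ⟨?_, (wp_addChildren hR' hst (x := x) (m := h) ?_ h8).mono ?_⟩
    · simp only [Test.Holds, h8, hst.1, List.length_append, List.length_cons]
      omega
    · rw [← hlen]
      simp
    · rintro t τ' - ⟨ht, hst', h8'⟩
      refine ⟨ht.trans (le_of_eq ?_), h8', ?_⟩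
      · congr 2
        simp only [expand, List.length_append, List.length_cons, List.length_nil]
        omega
      · simpa [expand] using hst'
  · rintro t τ ht hF ⟨h8, hst⟩
    have hlen : (W N).1.length = N := length_done le_rfl
    have hnil : (W N).2 = [] := todo_eq_nil d g q κ
    rw [hnil, List.append_nil] at hst
    refine ⟨by simp [Test.Holds, h8, hst.1, hlen], ?_, hst⟩
    have hsum : ∑ h ∈ Finset.range N, (7 + (12 * n + 12) * (ℓ (h + 1) - ℓ h) + 1) =
        8 * N + (12 * n + 12) * (ℓ N - ℓ 0) := by
      rw [← Finset.sum_range_tsub hmono, Finset.mul_sum]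
      simp only [Finset.sum_add_distrib, Finset.sum_const, Finset.card_range, smul_eq_mul]
      ring
    have hℓN : ℓ N - ℓ 0 ≤ N := by
      simp only [hℓ, hnil, hlen, List.length_nil]
      omega
    have := Nat.mul_le_mul_left (12 * n + 12) hℓN
    have hN1 : 1 ≤ N := Nat.choose_pos (Nat.le_add_right _ _)
    rw [hsum] at ht
    omega

/-- The entries of a matrix, indexed by natural numbers. -/
def entries {m n : ℕ} (M : Matrix (Fin m) (Fin n) ℝ) (i j : ℕ) : ℝ :=
  if h : i < m ∧ j < n then M ⟨i, h.1⟩ ⟨j, h.2⟩ else 0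

@[simp] theorem entries_val {m n : ℕ} (M : Matrix (Fin m) (Fin n) ℝ) (i : Fin m) (j : Fin n) :
    entries M i j = M i j := by
  simp [entries]

theorem HoldsMatrix.eq_entries {m n : ℕ} {A : ℕ → ℕ → ℝ} {M : Matrix (Fin m) (Fin n) ℝ}
    (h : HoldsMatrix A M) {i j : ℕ} (hi : i < m) (hj : j < n) : A i j = entries M i j := by
  simpa [entries, hi, hj] using h ⟨i, hi⟩ ⟨j, hj⟩

/-! ### The low-rank factors -/

/-- Used to pass from the exact rank `(g + d).choose g` to the stated bound. -/
theorem choose_le_choose_add (n k m : ℕ) : n.choose k ≤ (n + m).choose (k + m) := by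
  induction m with
  | zero => rfl
  | succ m ih =>
    refine ih.trans ?_
    rw [← add_assoc, ← add_assoc, Nat.choose_succ_succ]
    exact Nat.le_add_right _ _

theorem abs_mul_transpose_div_le {n d : ℕ} (hd : 1 ≤ d) {B : ℝ} (hB : 0 < B)
    {Q K : Matrix (Fin n) (Fin d) ℝ} (hQ : ‖Q‖ ≤ B) (hK : ‖K‖ ≤ B) (i j : Fin n) :
    |(Q * Kᵀ) i j / d| ≤ B ^ 2 := by
  have hd' : (0 : ℝ) < d := by exact_mod_cast hd
  rw [abs_div, abs_of_pos hd', div_le_iff₀ hd', Matrix.mul_apply]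
  calc |∑ w, Q i w * Kᵀ w j| ≤ ∑ w, |Q i w * Kᵀ w j| := Finset.abs_sum_le_sum_abs _ _
    _ ≤ ∑ _w : Fin d, B ^ 2 := by
        refine Finset.sum_le_sum fun w _ => ?_
        have h₁ : |Q i w| ≤ B := (Matrix.norm_entry_le_entrywise_sup_norm Q).trans hQ
        have h₂ : |K j w| ≤ B := (Matrix.norm_entry_le_entrywise_sup_norm K).trans hK
        rw [abs_mul, Matrix.transpose_apply, sq]
        exact mul_le_mul h₁ h₂ (abs_nonneg _) hB.le
    _ = B ^ 2 * d := by simp [mul_comm]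

theorem exists_factors {n d : ℕ} (hn : 1 ≤ n) (hd : 1 ≤ d) {B ε : ℝ} (hB : 0 < B) (hε : 0 < ε)
    (hε' : ε < 0.1) {Q K : Matrix (Fin n) (Fin d) ℝ} (hQ : ‖Q‖ ≤ B) (hK : ‖K‖ ≤ B) :
    ∃ (g k : ℕ) (U₁ U₂ : Matrix (Fin n) (Fin k) ℝ),
      0 < g ∧ (g : ℝ) ≤ 1000 * max 1 (degreeScale ε B) ∧
      0 < k ∧ k ≤ Nat.choose (2 * (g + d)) (2 * g) ∧
      IsLowRankApprox ε (expScores Q K) U₁ U₂ ∧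
      RunsWithin computeFactors (FactorInput g Q K) (FactorOutput U₁ U₂) (1000 * (n * k)) := by
  have hs : 1 ≤ max 1 (degreeScale ε B) := le_max_left _ _
  set s := max 1 (degreeScale ε B) with hs'
  set g := ⌈60 * s⌉₊ with hg
  have hg₁ : 60 * s ≤ g := Nat.le_ceil _
  have hg₂ : (g : ℝ) < 60 * s + 1 := Nat.ceil_lt_add_one (by linarith)
  have hg₀ : 0 < g := by
    have : (0 : ℝ) < g := by linarith
    exact_mod_cast this
  set L := (worklist d g (entries Q) (entries K) ((g + d).choose g)).1 with hL
  have hlen : L.length = (g + d).choose g := length_done le_rfl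
  have hk : 0 < L.length := hlen ▸ Nat.choose_pos (Nat.le_add_right _ _)
  set U₁ : Matrix (Fin n) (Fin L.length) ℝ := Matrix.of fun i l => (L[l]).u₁ i with hU₁
  set U₂ : Matrix (Fin n) (Fin L.length) ℝ := Matrix.of fun i l => (L[l]).u₂ i with hU₂
  have hprod : ∀ i j, (U₁ * U₂ᵀ) i j = expTaylor g ((Q * Kᵀ) i j / d) := by
    intro i j
    have h := sum_val_worklist hd g (entries Q) (entries K) i j
    rw [Finset.sum_range] at h
    simp only [entries_val] at h
    rw [Matrix.mul_apply, Matrix.mul_apply]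
    simp only [Matrix.transpose_apply]
    rw [← h, ← hL, ← Fin.sum_univ_fun_getElem]
    rfl
  have hclose : ∀ i j, |(U₁ * U₂ᵀ) i j - expScores Q K i j| ≤ ε * expScores Q K i j := by
    intro i j
    -- A Taylor polynomial of degree `g` has `g + 1` terms.
    have hN : 60 * max 1 (degreeScale ε B) ≤ ((g + 1 : ℕ) : ℝ) := by
      push_cast
      linarith
    obtain ⟨h₁, h₂⟩ := degree_condition hB hε hε' hN
    have h := abs_taylor_sub_exp_le (by positivity) h₁ h₂
      (abs_mul_transpose_div_le hd hB hQ hK i j)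
    rw [one_div, Real.log_inv, neg_neg, Real.exp_log hε] at h
    rw [hprod]
    exact h
  refine ⟨g, L.length, U₁, U₂, hg₀, by linarith, hk, ?_, ⟨fun i j => ?_, hclose⟩, ?_⟩
  · rw [hlen]
    calc (g + d).choose g ≤ (g + d + g).choose (g + g) := choose_le_choose_add _ _ _
      _ ≤ (2 * (g + d)).choose (g + g) := Nat.choose_le_choose _ (by omega)
      _ = _ := by rw [two_mul g]
  -- Nonnegativity follows from closeness, as `ε < 1`.
  · have h₁ := (abs_le.1 (hclose i j)).1
    nlinarith [expScores_pos Q K i j]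
  · rintro σ ⟨hσn, hσd, hσg, hσQ, hσK⟩
    obtain ⟨t, τ, he, ht, hτ, hst⟩ := wp_computeFactors hσn hσd hσg
      (fun i hi w hw => hσQ.eq_entries hi hw) (fun i hi w hw => hσK.eq_entries hi hw)
    have hF := he.frame
    rw [← hL] at hτ hst
    refine ⟨t, τ, he, ⟨hτ, ?_, ?_, hF.natReg 0 ?_, hF.natReg 1 ?_, hF.natReg 3 ?_,
      hF.realArr 2 ?_, hF.natArr 0 ?_, hF.natArr 1 ?_⟩, ?_⟩
    · exact fun i l => (hst l (L[l]) (by simp)).u₁ i i.isLt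
    · exact fun i l => (hst l (L[l]) (by simp)).u₂ i i.isLt
    iterate 6 simp [computeFactors, addChildren, addChild]
    · rw [← hlen] at ht
      have h₁ : L.length ≤ n * L.length := Nat.le_mul_of_pos_left _ hn
      have h₂ : n ≤ n * L.length := Nat.le_mul_of_pos_right _ hk
      have h₃ : (12 * n + 12) * L.length = 12 * (n * L.length) + 12 * L.length := by ring
      have h₄ : t ≤ 1000 * (n * L.length) := by omega
      exact_mod_cast h₄

/-! ### Running times for the various masks -/

/-- `X` is the quantity measuring the cost of one product for the given kind of mask. The factor
`40` covers all of them; the largest is `9 + 20 + 4 + 6 = 39`, for distinct columns. -/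
theorem exists_exec_attention {mv : Prog} (hk : mv.Safe) {n d k T X : ℕ} (hn : 1 ≤ n)
    (hd : 1 ≤ d) (hk₁ : 1 ≤ k) {U₁ U₂ : Matrix (Fin n) (Fin k) ℝ}
    {V : Matrix (Fin n) (Fin d) ℝ} {W : Matrix (Fin n) (Fin n) ℝ} {σ : State}
    (hin : AttentionInput U₁ U₂ V σ) {w : ℕ → ℕ → ℝ} (hw : ∀ i j : Fin n, w i j = W i j)
    (hmv : MulVecSpec mv n T w σ) (hpos : ∀ i, 0 < ∑ j, W i j * (U₁ * U₂ᵀ) i j)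
    (hX : n ≤ X) (hT : T ≤ 40 * X) :
    ∃ t τ, Exec (attention mv) σ t τ ∧
      AttentionOutput (maskedAttention W (U₁ * U₂ᵀ) V) σ τ ∧ (t : ℝ) ≤ 175 * (k * d * X) := by
  obtain ⟨h0, h1, h2, h3, h4, hV⟩ := hin
  have hnum : ∀ (i : Fin n) (y : Fin n → ℝ), ∑ l : Fin k, U₁ i l * ∑ j, W i j * (U₂ j l * y j) =
      ∑ j, W i j * (U₁ * U₂ᵀ) i j * y j := by
    intro i y
    simp only [Matrix.mul_apply, Matrix.transpose_apply, Finset.mul_sum, Finset.sum_mul]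
    rw [Finset.sum_comm]
    exact Finset.sum_congr rfl fun j _ => Finset.sum_congr rfl fun l _ => by ring
  have hnum' : ∀ (i c : ℕ) (hi : i < n) (hc : c < d), ∑ l ∈ Finset.range k, σ.realArr 3 i l *
      ∑ j ∈ Finset.range n, w i j * (σ.realArr 4 j l * σ.realArr 2 j c) =
      ∑ j, W ⟨i, hi⟩ j * (U₁ * U₂ᵀ) ⟨i, hi⟩ j * V j ⟨c, hc⟩ := by
    intro i c hi hc
    rw [← hnum, Finset.sum_range]
    refine Finset.sum_congr rfl fun l _ => ?_
    rw [Finset.sum_range, ← h3 ⟨i, hi⟩ l]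
    congr 1
    refine Finset.sum_congr rfl fun j _ => ?_
    rw [h4 j l, ← hw, ← hV j ⟨c, hc⟩]
  have hden' : ∀ (i : ℕ) (hi : i < n), ∑ l ∈ Finset.range k, σ.realArr 3 i l *
      ∑ j ∈ Finset.range n, w i j * σ.realArr 4 j l =
      ∑ j, W ⟨i, hi⟩ j * (U₁ * U₂ᵀ) ⟨i, hi⟩ j := by
    intro i hi
    have h := hnum ⟨i, hi⟩ 1
    simp only [Pi.one_apply, mul_one] at h
    rw [← h, Finset.sum_range]
    refine Finset.sum_congr rfl fun l _ => ?_
    rw [Finset.sum_range, ← h3 ⟨i, hi⟩ l]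
    congr 1
    exact Finset.sum_congr rfl fun j _ => by rw [h4 j l, ← hw]
  obtain ⟨t, τ, he, ht, hout⟩ := wp_attention hk h0 h1 h2 hmv fun i hi => by
    rw [hden' i hi]
    exact (hpos _).ne'
  refine ⟨t, τ, he, fun i c => ?_, ?_⟩
  · rw [hout i i.isLt c c.isLt, hnum' i c i.isLt c.isLt, hden' i i.isLt,
      maskedAttention_apply V fun i => (hpos i).ne']
  · have hX₁ : 1 ≤ X := hn.trans hX
    have hkX : X ≤ k * X := Nat.le_mul_of_pos_left _ hk₁
    -- `63 = 16 + 40 + 7` and `74 = 63 + 4 + 7`; finally `175 = 2 · 74 + 16 + 11`.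
    have ha : 4 * n + 7 + k * (16 * n + T + 7) ≤ 74 * (k * X) := by
      have : k * (16 * n + T + 7) ≤ k * (63 * X) := Nat.mul_le_mul_left k (by omega)
      have : k * (63 * X) = 63 * (k * X) := by ring
      omega
    have hb : (d + 1) * (4 * n + 7 + k * (16 * n + T + 7)) ≤ (2 * d) * (74 * (k * X)) :=
      Nat.mul_le_mul (by omega) ha
    have hc : n * (7 * d + 9) ≤ (k * X) * (16 * d) := Nat.mul_le_mul (by omega) (by omega)
    have hd₁ : 1 ≤ k * d * X := Nat.mul_pos (Nat.mul_pos hk₁ hd) hX₁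
    have hb' : (2 * d) * (74 * (k * X)) = 148 * (k * d * X) := by ring
    have hc' : (k * X) * (16 * d) = 16 * (k * d * X) := by ring
    have : t ≤ 175 * (k * d * X) := by omega
    exact_mod_cast this

theorem mulVecSpec_causal {n : ℕ} {W : Matrix (Fin n) (Fin n) ℝ} (hW : IsCausalMask W)
    (σ : State) : MulVecSpec mulVecCausal n (6 * n + 3) (entries W) σ := by
  intro τ hR _ _ _
  refine (wp_mulVecCausal hR).mono ?_
  rintro t ρ - ⟨ht, hy⟩
  refine ⟨ht, fun i hi => ?_⟩
  rw [hy i hi]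
  have h : ∀ j ∈ Finset.range n, entries W i j * τ.realArr 8 0 j =
      if j ≤ i then τ.realArr 8 0 j else 0 := by
    intro j hj
    have hj := Finset.mem_range.1 hj
    simp [entries, hi, hj, hW ⟨i, hi⟩ ⟨j, hj⟩]
  rw [Finset.sum_congr rfl h, ← Finset.sum_filter]
  congr 1
  ext j
  simp only [Finset.mem_range, Finset.mem_filter]
  omega

theorem mulVecSpec_continuous {n : ℕ} {W : Matrix (Fin n) (Fin n) ℝ} {s t : Fin n → Fin n}
    (hW : IsContinuousRowMask W s t) (hrow : ∀ i, ∃ j, W i j = 1) {σ : State}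
    (hσ : ContinuousRowInput s t σ) :
    MulVecSpec mulVecContinuous n (16 * n + 6) (entries W) σ := by
  intro τ hR _ h0 _
  have hs : ∀ i (hi : i < n), τ.natArr 0 i 0 = s ⟨i, hi⟩ ∧ τ.natArr 0 i 1 = t ⟨i, hi⟩ :=
    fun i hi => by rw [h0]; exact hσ ⟨i, hi⟩
  refine (wp_mulVecContinuous hR fun i hi => ?_).mono ?_
  · rw [(hs i hi).1, (hs i hi).2]
    exact ⟨Fin.isLt _, Fin.isLt _⟩
  rintro u ρ - ⟨hu, hy⟩
  refine ⟨hu, fun i hi => ?_⟩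
  -- Each row contains a `1`, so its interval is nonempty; otherwise the difference of prefix sums
  -- could be a nonzero number instead of the empty sum.
  have hst : (s ⟨i, hi⟩ : ℕ) ≤ t ⟨i, hi⟩ + 1 := by
    obtain ⟨j, hj⟩ := hrow ⟨i, hi⟩
    rw [hW] at hj
    split_ifs at hj with h
    · have h₁ : (s ⟨i, hi⟩ : ℕ) ≤ j := h.1
      have h₂ : (j : ℕ) ≤ t ⟨i, hi⟩ := h.2
      omega
    · simp at hj
  rw [hy i hi, (hs i hi).1, (hs i hi).2, ← Finset.sum_Ico_eq_sub _ hst]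
  have h : ∀ j ∈ Finset.range n, entries W i j * τ.realArr 8 0 j =
      if (s ⟨i, hi⟩ : ℕ) ≤ j ∧ j ≤ t ⟨i, hi⟩ then τ.realArr 8 0 j else 0 := by
    intro j hj
    have hj := Finset.mem_range.1 hj
    simp [entries, hi, hj, hW ⟨i, hi⟩ ⟨j, hj⟩, Fin.le_def]
  rw [Finset.sum_congr rfl h, ← Finset.sum_filter]
  congr 1
  ext j
  have := (t ⟨i, hi⟩).isLt
  simp only [Finset.mem_range, Finset.mem_filter, Finset.mem_Ico]
  omega

/-! ### Row change masks. -/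

/-- A list of `S.card` entries whose image is `S` has no repetition. -/
theorem HoldsSet.sum_eq {n : ℕ} {A : ℕ → ℕ} {S : Finset (Fin n)} (h : HoldsSet A S)
    (y : ℕ → ℝ) : ∑ m ∈ Finset.range (A 0), y (A (m + 1)) = ∑ l ∈ S, y l := by
  obtain ⟨h₀, h₁⟩ := h
  have hinj : Set.InjOn (fun m => A (m + 1)) (Finset.range S.card) := by
    rw [← Finset.card_image_iff, h₁, Finset.card_image_of_injective _ Fin.val_injective,
      Finset.card_range]
  rw [h₀, ← Finset.sum_image (f := y) hinj, h₁,
    Finset.sum_image (fun _ _ _ _ h => Fin.val_injective h)]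

theorem IsMask.prevRow {n : ℕ} {W : Matrix (Fin n) (Fin n) ℝ} (hW : IsMask W) (j l : Fin n) :
    prevRow W j l = 0 ∨ prevRow W j l = 1 := by
  unfold MaskedAttention.prevRow
  split_ifs
  · exact .inl rfl
  · exact hW _ _

theorem sum_added_sub_sum_removed {n : ℕ} {W : Matrix (Fin n) (Fin n) ℝ} (hW : IsMask W)
    (j : Fin n) (y : Fin n → ℝ) :
    ∑ l ∈ addedIndices W j, y l - ∑ l ∈ removedIndices W j, y l =
      ∑ l, (W j l - prevRow W j l) * y l := by
  rw [addedIndices, removedIndices, Finset.sum_filter, Finset.sum_filter,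
    ← Finset.sum_sub_distrib]
  refine Finset.sum_congr rfl fun l _ => ?_
  rcases hW j l with h | h <;> rcases hW.prevRow j l with h' | h' <;> simp [h, h']

theorem card_added_add_card_removed {n : ℕ} {W : Matrix (Fin n) (Fin n) ℝ} (hW : IsMask W)
    (j : Fin n) : (((addedIndices W j).card + (removedIndices W j).card : ℕ) : ℝ) =
      ∑ l, |W j l - prevRow W j l| := by
  rw [addedIndices, removedIndices, Finset.card_filter, Finset.card_filter,
    ← Finset.sum_add_distrib]
  push_cast
  refine Finset.sum_congr rfl fun l _ => ?_
  rcases hW j l with h | h <;> rcases hW.prevRow j l with h' | h' <;> simp [h, h']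

/-- The row differences telescope, starting from the zero row. -/
theorem sum_row_changes {n : ℕ} (W : Matrix (Fin n) (Fin n) ℝ) (y : Fin n → ℝ) {f : ℕ → ℝ}
    (hf : ∀ j : Fin n, f j = ∑ l, (W j l - prevRow W j l) * y l) (i : ℕ) (hi : i < n) :
    ∑ j ∈ Finset.range (i + 1), f j = ∑ l, W ⟨i, hi⟩ l * y l := by
  induction i with
  | zero => simpa [prevRow] using hf ⟨0, hi⟩
  | succ i ih =>
    rw [Finset.sum_range_succ, ih (by omega), hf ⟨i + 1, hi⟩, ← Finset.sum_add_distrib]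
    refine Finset.sum_congr rfl fun l _ => ?_
    simp only [prevRow, Nat.add_eq_zero_iff, one_ne_zero, and_false, if_false,
      Nat.add_sub_cancel]
    ring

theorem mulVecSpec_rowChange {n : ℕ} {W : Matrix (Fin n) (Fin n) ℝ} (hW : IsMask W)
    {b : Fin n → ℕ} (hb : IsRowChangeMask W b) {σ : State} (hσ : RowChangeInput W σ) :
    MulVecSpec mulVecRowChange n (10 * n + 8 * ∑ j, b j + 3) (entries W) σ := by
  intro τ hR _ h0 h1
  refine (wp_mulVecRowChange hR).mono ?_
  rintro t ρ - ⟨ht, hy⟩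
  rw [h0, h1] at ht hy
  constructor
  · have : ∑ i ∈ Finset.range n, (σ.natArr 0 i 0 + σ.natArr 1 i 0) ≤ ∑ j, b j := by
      rw [Finset.sum_range]
      refine Finset.sum_le_sum fun j _ => ?_
      rw [(hσ j).1.1, (hσ j).2.1]
      have h := hb j
      rw [← card_added_add_card_removed hW] at h
      exact_mod_cast h
    omega
  · intro i hi
    rw [hy i hi, sum_row_changes W (fun l => τ.realArr 8 0 l) (fun j => ?_) i hi,
      Finset.sum_range]
    · refine Finset.sum_congr rfl fun l _ => ?_
      simp [entries, hi]
    · rw [(hσ j).1.sum_eq, (hσ j).2.sum_eq, ← sum_added_sub_sum_removed hW]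

/-! ### Masks with few distinct columns or rows. -/

theorem DistinctInput.label {n r : ℕ} {W : Matrix (Fin n) (Fin n) ℝ}
    {S : Fin r → Finset (Fin n)} {σ : State} (hσ : DistinctInput W S σ)
    (hS : IsIndexPartition S) {i : ℕ} (hi : i < n) :
    ∃ j : Fin r, ⟨i, hi⟩ ∈ S j ∧ σ.natArr 0 i 0 = j := by
  obtain ⟨j, hj⟩ := hS.2 ⟨i, hi⟩
  exact ⟨j, hj, hσ.2.1 j _ hj⟩

theorem mulVecSpec_columns {n r : ℕ} {W : Matrix (Fin n) (Fin n) ℝ}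
    {S : Fin r → Finset (Fin n)} (hS : IsDistinctColumnsMask W S) {σ : State}
    (hσ : DistinctInput W S σ) :
    MulVecSpec mulVecColumns n (9 * (n * r) + 20 * n + 4 * r + 6)
      (fun i j => (σ.natArr 1 i j : ℝ)) σ := by
  intro τ hR h3 h0 h1
  have h := wp_mulVecColumns hR (h3.trans hσ.1) (fun i hi => ?_) (fun j hj j' hj' hjj i hi => ?_)
  · rwa [h1] at h
  · obtain ⟨l, -, hl⟩ := hσ.label hS.1 hi
    rw [h0, hl]
    exact l.isLt
  · obtain ⟨l, hl, hl'⟩ := hσ.label hS.1 hj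
    obtain ⟨m, hm, hm'⟩ := hσ.label hS.1 hj'
    rw [h0, hl', hm'] at hjj
    obtain rfl := Fin.val_injective hjj
    have h := congrFun (hS.2 l _ hl _ hm) ⟨i, hi⟩
    simp only [Matrix.col_apply] at h
    rw [← hσ.2.2, ← hσ.2.2] at h
    rw [h1]
    exact_mod_cast h

theorem mulVecSpec_rows {n r : ℕ} {W : Matrix (Fin n) (Fin n) ℝ}
    {S : Fin r → Finset (Fin n)} (hS : IsDistinctRowsMask W S) {σ : State}
    (hσ : DistinctInput W S σ) :
    MulVecSpec mulVecRows n (8 * (n * r) + 11 * n + 8 * r + 6)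
      (fun i j => (σ.natArr 1 i j : ℝ)) σ := by
  intro τ hR h3 h0 h1
  have h := wp_mulVecRows hR (h3.trans hσ.1) (fun i hi => ?_) (fun j hj j' hj' hjj i hi => ?_)
  · rwa [h1] at h
  · obtain ⟨l, -, hl⟩ := hσ.label hS.1 hi
    rw [h0, hl]
    exact l.isLt
  · obtain ⟨l, hl, hl'⟩ := hσ.label hS.1 hj
    obtain ⟨m, hm, hm'⟩ := hσ.label hS.1 hj'
    rw [h0, hl', hm'] at hjj
    obtain rfl := Fin.val_injective hjj
    have h := congrFun (hS.2 l _ hl _ hm) ⟨i, hi⟩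
    simp only [Matrix.row_apply] at h
    rw [← hσ.2.2, ← hσ.2.2] at h
    rw [h1]
    exact_mod_cast h

/-- Gives `n ≤ n * r`, so that linear terms are absorbed by `n * r`. -/
theorem IsIndexPartition.one_le {n r : ℕ} {S : Fin r → Finset (Fin n)} (hS : IsIndexPartition S)
    (hn : 1 ≤ n) : 1 ≤ r := by
  obtain ⟨j, -⟩ := hS.2 ⟨0, hn⟩
  exact j.pos

end MaskedAttention

/-! ### Assembly of the theorem. -/

open MaskedAttention
theorem theorem5p5 :
    ∃ (C : ℝ) (factorProg causalProg rowChangeProg continuousProg columnsProg rowsProg : Prog),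
      ∀ (n d : ℕ) (_hn : 1 ≤ n) (_hd : 1 ≤ d) (B ε : ℝ) (_hB : 0 < B)
        (_hε : ε ∈ Set.Ioo (0 : ℝ) 0.1) (Q K : Matrix (Fin n) (Fin d) ℝ)
        (_hQ : ‖Q‖ ≤ B) (_hK : ‖K‖ ≤ B),
        -- existence and computation of the low-rank factors
        (∃ (g k : ℕ) (U₁ U₂ : Matrix (Fin n) (Fin k) ℝ),
          0 < g ∧ (g : ℝ) ≤ C * max 1 (degreeScale ε B) ∧
          0 < k ∧ k ≤ Nat.choose (2 * (g + d)) (2 * g) ∧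
          IsLowRankApprox ε (expScores Q K) U₁ U₂ ∧
          RunsWithin factorProg (FactorInput g Q K) (FactorOutput U₁ U₂) (C * (n * k))) ∧
        -- error bound and running times, for any such factors
        ∀ (k : ℕ) (_hk : 1 ≤ k) (U₁ U₂ : Matrix (Fin n) (Fin k) ℝ)
          (_hU : IsLowRankApprox ε (expScores Q K) U₁ U₂)
          (V : Matrix (Fin n) (Fin d) ℝ) (W : Matrix (Fin n) (Fin n) ℝ)
          (_hW : IsMask W) (_hrow : ∀ i, ∃ j, W i j = 1),
          IsUnit (rowSumDiag (W ⊙ expScores Q K)) ∧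
          IsUnit (rowSumDiag (W ⊙ (U₁ * U₂ᵀ))) ∧
          ‖maskedAttention W (expScores Q K) V - maskedAttention W (U₁ * U₂ᵀ) V‖ ≤
            4 * ε * ‖V‖ ∧
          (IsCausalMask W →
            RunsWithin causalProg (AttentionInput U₁ U₂ V)
              (AttentionOutput (maskedAttention W (U₁ * U₂ᵀ) V)) (C * (k * n * d))) ∧
          (∀ b : Fin n → ℕ, IsRowChangeMask W b →
            RunsWithin rowChangeProg
              (fun σ => AttentionInput U₁ U₂ V σ ∧ RowChangeInput W σ)
              (AttentionOutput (maskedAttention W (U₁ * U₂ᵀ) V))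
              (C * (k * d * max (n : ℝ) (∑ j, (b j : ℝ))))) ∧
          (∀ s t : Fin n → Fin n, IsContinuousRowMask W s t → 2 ≤ n →
            RunsWithin continuousProg
              (fun σ => AttentionInput U₁ U₂ V σ ∧ ContinuousRowInput s t σ)
              (AttentionOutput (maskedAttention W (U₁ * U₂ᵀ) V))
              (C * (k * n * d * Real.log n))) ∧
          (∀ (r : ℕ) (S : Fin r → Finset (Fin n)), IsDistinctColumnsMask W S →
            RunsWithin columnsProg
              (fun σ => AttentionInput U₁ U₂ V σ ∧ DistinctInput W S σ)
              (AttentionOutput (maskedAttention W (U₁ * U₂ᵀ) V)) (C * (k * r * n * d))) ∧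
          (∀ (r : ℕ) (S : Fin r → Finset (Fin n)), IsDistinctRowsMask W S →
            RunsWithin rowsProg
              (fun σ => AttentionInput U₁ U₂ V σ ∧ DistinctInput W S σ)
              (AttentionOutput (maskedAttention W (U₁ * U₂ᵀ) V)) (C * (k * r * n * d))) := by
  -- A generous common constant: `g ≤ 60 s + 1` with `s ≥ 1`, and the masks need `175`, or `350` for
  -- continuous rows.
  refine ⟨1000, computeFactors, attention mulVecCausal, attention mulVecRowChange,
    attention mulVecContinuous, attention mulVecColumns, attention mulVecRows, ?_⟩
  intro n d hn hd B ε hB hε Q K hQ hK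
  refine ⟨exists_factors hn hd hB hε.1 hε.2 hQ hK, ?_⟩
  intro k hk U₁ U₂ hU V W hW hrow
  have hε₁ : ε < 1 := hε.2.trans (by norm_num)
  have hH := expScores_pos Q K
  have hG := hU.pos hε₁ hH
  have hpos := masked_row_sum_pos hW hrow hG
  refine ⟨isUnit_rowSumDiag fun i => (masked_row_sum_pos hW hrow hH i).ne',
    isUnit_rowSumDiag fun i => (hpos i).ne',
    norm_maskedAttention_sub_le V hW hrow hε.1.le hH hG hU.close, ?_, ?_, ?_, ?_, ?_⟩
  · intro hC σ hσ
    obtain ⟨t, τ, he, ho, ht⟩ := exists_exec_attention safe_mulVecCausal hn hd hk hσ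
      (entries_val W) (mulVecSpec_causal hC σ) hpos le_rfl (by omega)
    refine ⟨t, τ, he, ho, ht.trans ?_⟩
    have : (0 : ℝ) ≤ k * d * n := by positivity
    linarith
  · rintro b hb σ ⟨hσ, hσ'⟩
    obtain ⟨t, τ, he, ho, ht⟩ := exists_exec_attention safe_mulVecRowChange hn hd hk hσ
      (entries_val W) (mulVecSpec_rowChange hW hb hσ') hpos
      (le_max_left n (∑ j, b j)) (by
        have h₁ := le_max_left n (∑ j, b j)
        have h₂ := le_max_right n (∑ j, b j)
        omega)
    refine ⟨t, τ, he, ho, ht.trans ?_⟩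
    push_cast
    have : (0 : ℝ) ≤ k * d * max (n : ℝ) (∑ j, (b j : ℝ)) := by positivity
    linarith
  · rintro s t hst hn₂ σ ⟨hσ, hσ'⟩
    obtain ⟨u, τ, he, ho, hu⟩ := exists_exec_attention safe_mulVecContinuous hn hd hk hσ
      (entries_val W) (mulVecSpec_continuous hst hrow hσ') hpos le_rfl (by omega)
    refine ⟨u, τ, he, ho, hu.trans ?_⟩
    -- The program is linear in `n`; the factor `log n` of the claimed bound only has to be bounded
    -- below, which is where `2 ≤ n` enters.
    have hlog : 1 / 2 ≤ Real.log n := by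
      have h₁ := Real.log_two_gt_d9
      have h₂ : Real.log 2 ≤ Real.log n :=
        Real.log_le_log (by norm_num) (by exact_mod_cast hn₂)
      linarith
    have h₀ : (0 : ℝ) ≤ k * n * d := by positivity
    nlinarith [mul_le_mul_of_nonneg_left hlog h₀]
  · rintro r S hS σ ⟨hσ, hσ'⟩
    have hr := hS.1.one_le hn
    have h₁ : n ≤ n * r := Nat.le_mul_of_pos_right _ hr
    have h₂ : r ≤ n * r := Nat.le_mul_of_pos_left _ hn
    obtain ⟨t, τ, he, ho, ht⟩ := exists_exec_attention safe_mulVecColumns hn hd hk hσ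
      hσ'.2.2 (mulVecSpec_columns hS hσ') hpos h₁ (by omega)
    refine ⟨t, τ, he, ho, ht.trans ?_⟩
    push_cast
    have : (0 : ℝ) ≤ k * r * n * d := by positivity
    linarith
  · rintro r S hS σ ⟨hσ, hσ'⟩
    have hr := hS.1.one_le hn
    have h₁ : n ≤ n * r := Nat.le_mul_of_pos_right _ hr
    have h₂ : r ≤ n * r := Nat.le_mul_of_pos_left _ hn
    obtain ⟨t, τ, he, ho, ht⟩ := exists_exec_attention safe_mulVecRows hn hd hk hσ
      hσ'.2.2 (mulVecSpec_rows hS hσ') hpos h₁ (by omega)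
    refine ⟨t, τ, he, ho, ht.trans ?_⟩
    push_cast
    have : (0 : ℝ) ≤ k * r * n * d := by positivity
    linarith
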